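/- Let $N,K,K'\ge 1$ be integers with $K\le K'$, and let $M\in[0,N]$ and $r\ge 1$ be real numbers. A server holds $N$ files $W_1,\dots,W_N$, each consisting of $F$ symbols of a finite field of characteristic $2$ (so that addition is bitwise XOR $\oplus$). **Placement.** Each file $W_n$ is encoded by a $(\lfloor rF\rfloor,F)$ MDS code into $W'_n$ with $\lfloor rF\rfloor$ symbols (any $F$ of which determine $W_n$). Each of $K'$ users, independently for all users and files, caches a uniformly random set of exactly $\lfloor MF/N\rfloor$ symbols of each $W'_n$; so it caches at most $MF$ symbols. **Delivery.** Any $K$ of the users, numbered $1,\dots,K$, request files $\mathbf d=(d_1,\dots,d_K)\in[N]^K$. For $B\subseteq[K]$ let $W'_{n,B}$ be the sequence (in increasing order of position) of those symbols of $W'_n$ that are cached by exactly the users of $B$ among the $K$ requesting ones. Let $\mathcal U\subseteq[K]$ be a set of leaders, i.e. the $d_k$, $k\in\mathcal U$, are distinct and exhaust the requested files. For $j=K,K-1,\dots,1$ the server sends, for each $S\subseteq[K]$ with $|S|=j$ and $S\cap\mathcal U\neq\emptyset$, the first $\ell_j$ symbols of $\bigoplus_{k\in S}W'_{d_k,S\setminus\{k\}}$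 (segments padded with zeros), where $\ell_j$ is the smallest number such that either the messages of round $j$ are covered entirely ($\ell_j\ge|W'_{d_k,S\setminus\{k\}}|$ for all $|S|=j$, $k\in S$), or every user $k$ has at least $F$ symbols of $W'_{d_k}$, counting its cached symbols of $W'_{d_k}$ and $\sum_{S\ni k,|S|=i}\min\{\ell_i,|W'_{d_k,S\setminus\{k\}}|\}$ for each round $i\ge j$. (Thus $\ell_j=0$ once every user has $F$ symbols; if all the segments in round $j$ have the same size $g$ and all users had $a$ symbols before, then $\ell_j=\lceil\min\{g\binom{K-1}{j-1},F-a\}/\binom{K-1}{j-1}\rceil$, where $F-a$ is read as $0$ if $a>F$.) The normalized rate $R(\mathbf d)$ is the number of symbols sent, divided by $F$, and the worst-case normalized rate is $\max_{\mathbf d}R(\mathbf d)$. Let $q=\frac{M}{rN}$, $J=\min\{N,K\}$ and, for $x\ge1$, $$A(x)=\frac MN+\sum_{j=x}^{K}r q^{j-1}(1-q)^{K-j+1}\binom{K-1}{j-1}.$$ **Theorem.** 1. If $M<N$, there is exactly one $s\in\{1,\dots,K\}$ with $A(s+1)<1\le A(s)$. 2. For every $F$ there is a linear $(\lfloor rF\rfloor,F)$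 MDS code over some finite field of characteristic $2$. With any (not necessarily linear) such code, for every realization of the caches, every choice of the $K$ requesting users, all requests $\mathbf d$ and every choice of leaders, each requesting user $k$ recovers $W_{d_k}$ from its cache and the transmitted symbols. 3. If $s\in\{1,\dots,K\}$ satisfies $A(s+1)<1\le A(s)$, then, as $F\to\infty$, the worst-case normalized rate converges in probability (over the random placement; uniformly over the choice of the $K$ requesting users and of the leaders) to $$R_{\mathrm{dec}}=\sum_{j=s+1}^{K}r q^{j-1}(1-q)^{K-j+1}\left(\binom Kj-\binom{K-J}{j}\right)+\frac{1-A(s+1)}{\binom{K-1}{s-1}}\left(\binom Ks-\binom{K-J}{s}\right).$$ -/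

import Mathlib

open Finset

namespace CodedCaching

/-! ### MDS codes -/

/-- `enc` encodes `m` symbols into `n` symbols in such a way that any `m` of the `n` coded symbols
determine the message: an `(n, m)` MDS code. -/
def IsMDS {𝔽 : Type} {m n : ℕ} (enc : (Fin m → 𝔽) → (Fin n → 𝔽)) : Prop :=
  m ≤ n ∧ ∀ T : Finset (Fin n), T.card = m →
    ∀ w w' : Fin m → 𝔽, (∀ t ∈ T, enc w t = enc w' t) → w = w'

/-! ### Placement phase -/

/-- A placement for `K'` users and `N` coded files of `n` symbols each: every user picks, for every
coded file, a set of exactly `c` positions to cache. -/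
def Placement (K' N n c : ℕ) : Type :=
  Fin K' → Fin N → {T : Finset (Fin n) // T.card = c}

instance (K' N n c : ℕ) : Fintype (Placement K' N n c) :=
  inferInstanceAs (Fintype (Fin K' → Fin N → {T : Finset (Fin n) // T.card = c}))

instance (K' N n c : ℕ) : MeasurableSpace (Placement K' N n c) := ⊤

/-- The law of the random placement. Uniform on the finite product: all users and files choose
independently, each one uniformly among the sets of `c` positions. -/
noncomputable def placementLaw (K' N n c : ℕ) : MeasureTheory.Measure (Placement K' N n c) :=
  ProbabilityTheory.uniformOn Set.univ

/-- Positions cached by the `K` users that make a request: `Z k i` are the positions of coded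
file `i` that requesting user `k` has cached. -/
abbrev Caches (K N n : ℕ) : Type := Fin K → Fin N → Finset (Fin n)

/-- The caches of the requesting users `e 0, …, e (K-1)` among the `K'` users. -/
def Placement.caches {K K' N n c : ℕ} (ω : Placement K' N n c) (e : Fin K ↪ Fin K') :
    Caches K N n :=
  fun k i => (ω (e k) i).1

/-- Number of symbols of each coded file, `r F`. -/
noncomputable def codeLength (r : ℝ) (F : ℕ) : ℕ := ⌊r * F⌋₊

/-- Number of symbols of each coded file that a user caches, `M F / N`. -/
noncomputable def cacheShare (M : ℝ) (N F : ℕ) : ℕ := ⌊M * F / N⌋₊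

/-! ### Delivery phase -/

section Delivery

variable {K N n : ℕ}

/-- Positions of the segment `W'_{i,A}`: the symbols of coded file `i` that are cached by exactly
the requesting users in `A`. -/
def segment (Z : Caches K N n) (i : Fin N) (A : Finset (Fin K)) : Finset (Fin n) :=
  univ.filter fun t => ∀ k, t ∈ Z k i ↔ k ∈ A

/-- The `p`-th symbol of the segment of the coded file `w` at the positions `T` (in increasing
order), with zero padding beyond the end. -/
def paddedSymbol {𝔽 : Type} [Zero 𝔽] (w : Fin n → 𝔽) (T : Finset (Fin n)) (p : ℕ) : 𝔽 :=
  if h : p < T.card then w (T.orderEmbOfFin rfl ⟨p, h⟩) else 0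

/-- `U` is a set of leaders for the requests `d`: its members request different files, and every
requested file is requested by one of them. -/
def IsLeaderSet (d : Fin K → Fin N) (U : Finset (Fin K)) : Prop :=
  Set.InjOn d (U : Set (Fin K)) ∧ U.image d = univ.image d

/-- Length of the longest segment `W'_{d_k, S \ {k}}` with `k ∈ S`, `|S| = j`, that is, the common
length of the zero-padded messages of iteration `j`. -/
def seg (Z : Caches K N n) (d : Fin K → Fin N) (j : ℕ) : ℕ :=
  (powersetCard j univ).sup fun S => S.sup fun k => (segment Z (d k) (S.erase k)).card

/-- Number of symbols of its requested file that user `k` gets in iteration `j` when the first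
`l` symbols of each of the messages of that iteration are delivered. -/
def gain (Z : Caches K N n) (d : Fin K → Fin N) (j l : ℕ) (k : Fin K) : ℕ :=
  ∑ S ∈ (powersetCard j univ).filter (fun S => k ∈ S),
    min l (segment Z (d k) (S.erase k)).card

/-- Number of symbols sent of each message in iteration `j`, if user `k` already has `acc k`
symbols of its requested file: the whole messages, or, if that is shorter, just so many symbols
that every user attains `F` symbols. If all users have `F` symbols, this is `0`: the
iteration has ended. -/
noncomputable def roundLength (Z : Caches K N n) (d : Fin K → Fin N) (F j : ℕ)
    (acc : Fin K → ℕ) : ℕ :=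
  sInf {l | seg Z d j ≤ l ∨ ∀ k, F ≤ acc k + gain Z d j l k}

/-- If all segments that occur in iteration `j` have the same size `g` and all users have the same
number `a` of symbols, then `roundLength` is `min {g * C, F - a} / C` with `C = (K-1 choose j-1)`,
rounded up. -/
theorem roundLength_of_equal (Z : Caches K N n) (d : Fin K → Fin N) (F j g a : ℕ)
    (hj : 1 ≤ j) (hjK : j ≤ K)
    (hg : ∀ S : Finset (Fin K), S.card = j → ∀ k ∈ S, (segment Z (d k) (S.erase k)).card = g) :
    roundLength Z d F j (fun _ => a) =
      min (g * (K - 1).choose (j - 1)) (F - a) ⌈/⌉ (K - 1).choose (j - 1) := by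
  have hC : 0 < (K - 1).choose (j - 1) := Nat.choose_pos (by omega)
  have hgain : ∀ l k, gain Z d j l k = (K - 1).choose (j - 1) * min l g := by
    intro l k
    have hcard : ((powersetCard j (univ : Finset (Fin K))).filter (fun S => k ∈ S)).card =
        (K - 1).choose (j - 1) := by
      have : (powersetCard j (univ : Finset (Fin K))).filter (fun S => k ∈ S) =
          (powersetCard (j - 1) (univ.erase k)).image (insert k) := by
        ext S
        simp only [mem_filter, mem_powersetCard, subset_univ, true_and, mem_image]
        constructor
        · rintro ⟨h1, h2⟩
          exact ⟨S.erase k, ⟨erase_subset_erase k (subset_univ S), by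
            rw [card_erase_of_mem h2, h1]⟩, insert_erase h2⟩
        · rintro ⟨T, ⟨h1, h2⟩, rfl⟩
          have hk : k ∉ T := fun h => by simpa using h1 h
          exact ⟨by rw [card_insert_of_notMem hk, h2]; omega, mem_insert_self k T⟩
      rw [this, card_image_of_injOn, card_powersetCard]
      · simp
      · intro S hS T hT h
        have hS : k ∉ S := fun h => by simpa using (mem_powersetCard.1 hS).1 h
        have hT : k ∉ T := fun h => by simpa using (mem_powersetCard.1 hT).1 h
        rw [← erase_insert hS, ← erase_insert hT]
        exact congrArg (fun X => X.erase k) h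
    rw [gain, ← hcard, ← smul_eq_mul, ← sum_const]
    refine sum_congr rfl fun S hS => ?_
    rw [mem_filter, mem_powersetCard] at hS
    rw [hg S hS.1.2 k hS.2]
  have hseg : seg Z d j = g := by
    refine le_antisymm (Finset.sup_le fun S hS => Finset.sup_le fun k hk => ?_) ?_
    · exact (hg S (mem_powersetCard.1 hS).2 k hk).le
    · obtain ⟨S, -, hS⟩ := exists_subset_card_eq (s := (univ : Finset (Fin K))) (n := j)
        (by simpa using hjK)
      obtain ⟨k, hk⟩ := card_pos.1 (by omega : 0 < S.card)
      rw [← hg S hS k hk]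
      exact (le_sup (f := fun k => (segment Z (d k) (S.erase k)).card) hk).trans
        (le_sup (f := fun S => S.sup fun k => (segment Z (d k) (S.erase k)).card)
          (mem_powersetCard.2 ⟨subset_univ S, hS⟩))
  have k0 : Fin K := ⟨0, by omega⟩
  rw [roundLength, hseg]
  simp only [hgain]
  generalize (K - 1).choose (j - 1) = C at *
  refine le_antisymm (Nat.sInf_le ?_) (le_csInf ⟨g, Or.inl le_rfl⟩ ?_)
  · have h := le_smul_ceilDiv hC (b := min (g * C) (F - a))
    rw [smul_eq_mul] at h
    rcases le_total (g * C) (F - a) with h1 | h1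
    · left
      rw [min_eq_left h1] at h ⊢
      exact Nat.le_of_mul_le_mul_left (by linarith) hC
    · right
      rw [min_eq_right h1] at h ⊢
      have h2 : (F - a) ⌈/⌉ C ≤ g := by
        rw [ceilDiv_le_iff_le_smul hC, smul_eq_mul]; linarith
      intro _
      rw [min_eq_left h2]
      omega
  · rintro l hl
    rw [ceilDiv_le_iff_le_smul hC, smul_eq_mul]
    rcases hl with hl | hl
    · exact (min_le_left _ _).trans (by nlinarith)
    · refine (min_le_right _ _).trans ?_
      have h1 := hl k0
      have h2 : C * min l g ≤ C * l := Nat.mul_le_mul_left _ (min_le_left _ _)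
      omega

/-- Number of symbols of its requested file that each user has after the `m` iterations
`j = K, K - 1, …, K - m + 1`. -/
noncomputable def accAfter (Z : Caches K N n) (d : Fin K → Fin N) (F : ℕ) : ℕ → Fin K → ℕ
  | 0 => fun k => (Z k (d k)).card
  | m + 1 => fun k => accAfter Z d F m k +
      gain Z d (K - m) (roundLength Z d F (K - m) (accAfter Z d F m)) k

/-- Number of symbols that are sent of each message in iteration `j`, for `1 ≤ j ≤ K`. -/
noncomputable def incr (Z : Caches K N n) (d : Fin K → Fin N) (F j : ℕ) : ℕ :=
  roundLength Z d F j (accAfter Z d F (K - j))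

/-- Index set of the symbols that the server sends: for each set `S` of requesting users that
contains a leader, the first `incr` symbols of the message for `S`. -/
noncomputable def sent (Z : Caches K N n) (d : Fin K → Fin N) (F : ℕ) (U : Finset (Fin K)) :
    Finset (Σ _ : Finset (Fin K), ℕ) :=
  (univ.filter fun S : Finset (Fin K) => (S ∩ U).Nonempty).sigma
    fun S => range (incr Z d F S.card)

/-- Total number of symbols sent in the delivery phase. -/
noncomputable def load (Z : Caches K N n) (d : Fin K → Fin N) (F : ℕ) (U : Finset (Fin K)) : ℕ :=
  (sent Z d F U).card

/-- Worst-case normalized rate `max_d R(d)`, when `U d` are the leaders for the requests `d`. -/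
noncomputable def worstRate (Z : Caches K N n) (F : ℕ)
    (U : (Fin K → Fin N) → Finset (Fin K)) : ℝ :=
  ((univ.sup fun d => load Z d F (U d) : ℕ) : ℝ) / F

/-- The cache content of user `k`. -/
def cacheContent {𝔽 : Type} {F : ℕ} (enc : (Fin F → 𝔽) → (Fin n → 𝔽)) (Z : Caches K N n)
    (k : Fin K) (W : Fin N → Fin F → 𝔽) : (i : Fin N) → {t // t ∈ Z k i} → 𝔽 :=
  fun i t => enc (W i) t

/-- What the server sends: the symbol number `p` of the message for `S` is that of
`⊕_{k ∈ S} W'_{d_k, S \ {k}}`. In characteristic `2`, addition is the bitwise XOR. -/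
noncomputable def transmission {𝔽 : Type} [AddCommMonoid 𝔽] {F : ℕ}
    (enc : (Fin F → 𝔽) → (Fin n → 𝔽)) (Z : Caches K N n) (d : Fin K → Fin N)
    (U : Finset (Fin K)) (W : Fin N → Fin F → 𝔽) : {x // x ∈ sent Z d F U} → 𝔽 :=
  fun x => ∑ k ∈ x.1.1, paddedSymbol (enc (W (d k))) (segment Z (d k) (x.1.1.erase k)) x.1.2

/-- User `k` can recover its requested file from its cache and the transmission. -/
def CanDecode {𝔽 : Type} [AddCommMonoid 𝔽] {F : ℕ} (enc : (Fin F → 𝔽) → (Fin n → 𝔽))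
    (Z : Caches K N n) (d : Fin K → Fin N) (U : Finset (Fin K)) (k : Fin K) : Prop :=
  ∃ dec : ((i : Fin N) → {t // t ∈ Z k i} → 𝔽) → ({x // x ∈ sent Z d F U} → 𝔽) → (Fin F → 𝔽),
    ∀ W : Fin N → Fin F → 𝔽,
      dec (cacheContent enc Z k W) (transmission enc Z d U W) = W (d k)

end Delivery

/-! ### The rate formula -/

/-- `q = M / (r N)` -/
noncomputable def q (N : ℕ) (M r : ℝ) : ℝ := M / (r * N)

/-- The accumulation function `A(x)`, for `x ≥ 1`. -/
noncomputable def A (N K : ℕ) (M r : ℝ) (x : ℕ) : ℝ :=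
  M / N + ∑ j ∈ Icc x K,
    r * q N M r ^ (j - 1) * (1 - q N M r) ^ (K - j + 1) * ((K - 1).choose (j - 1) : ℝ)

/-- `s` is the index of the last iteration: `A(s+1) < 1 ≤ A(s)`. -/
def IsThreshold (N K : ℕ) (M r : ℝ) (s : ℕ) : Prop :=
  1 ≤ s ∧ s ≤ K ∧ A N K M r (s + 1) < 1 ∧ 1 ≤ A N K M r s

/-- The rate `R_dec`, with `J = min {N, K}`. -/
noncomputable def Rdec (N K : ℕ) (M r : ℝ) (s : ℕ) : ℝ :=
  (∑ j ∈ Icc (s + 1) K, r * q N M r ^ (j - 1) * (1 - q N M r) ^ (K - j + 1) *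
      ((K.choose j : ℝ) - ((K - min N K).choose j : ℝ))) +
    (1 - A N K M r (s + 1)) / ((K - 1).choose (s - 1) : ℝ) *
      ((K.choose s : ℝ) - ((K - min N K).choose s : ℝ))

end CodedCaching

/-!
*Decoding.* Fix a set `B` of users. Removing from `B` a set `V` of leaders and summing the messages
of `B \ V` over all `V ⊆ B`, the terms cancel in pairs, because a set `V ∪ {k}` can be split into
leaders and a further user in exactly two ways. So a message without leaders is a sum of messages of
the same round that are sent, and every user obtains at least `F` coded symbols of its file.

*Rate.* The number of cached symbols of a file is fixed, so the positions in a segment are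
negatively correlated, and by Chebyshev's inequality all segments have about their expected size.
As long as they do, each round of the delivery moves the symbol counts only a bounded factor further
from their idealised values, and the load is close to a sum that increases with the number of
different requested files, which is at most `min N K`.
-/

namespace CodedCaching

section Threshold

variable {N K : ℕ} {M r : ℝ}

/-- The idealised size, in units of `F`, of a segment `W'_{i,B}` with `b = |B|`: each of the `r F`
coded symbols is cached by a given user with probability `q`. -/
noncomputable def segmentDensity (N K : ℕ) (M r : ℝ) (b : ℕ) : ℝ :=
  r * q N M r ^ b * (1 - q N M r) ^ (K - b)

theorem q_nonneg (hM0 : 0 ≤ M) (hr : 1 ≤ r) : 0 ≤ q N M r := by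
  unfold q; positivity

theorem q_le_one (hMN : M ≤ N) (hr : 1 ≤ r) : q N M r ≤ 1 :=
  div_le_one_of_le₀ (hMN.trans (le_mul_of_one_le_left N.cast_nonneg hr)) (by positivity)

theorem mul_q (hr : 1 ≤ r) : r * q N M r = M / N := by
  unfold q
  field_simp

theorem segmentDensity_nonneg (hM0 : 0 ≤ M) (hMN : M ≤ N) (hr : 1 ≤ r) (b : ℕ) :
    0 ≤ segmentDensity N K M r b := by
  have h0 := q_nonneg (N := N) hM0 hr
  have h1 := sub_nonneg.2 (q_le_one hMN hr)
  unfold segmentDensity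
  positivity

theorem A_eq_sum_segmentDensity {x : ℕ} (hx : 1 ≤ x) :
    A N K M r x =
      M / N + ∑ j ∈ Icc x K, (K - 1).choose (j - 1) * segmentDensity N K M r (j - 1) := by
  unfold A segmentDensity
  congr 1
  refine sum_congr rfl fun j hj => ?_
  have hj := mem_Icc.1 hj
  rw [show K - j + 1 = K - (j - 1) by lia]
  ring

theorem A_last : A N K M r (K + 1) = M / N := by
  simp [A]

theorem A_eq_add {j : ℕ} (hj : 1 ≤ j) (hjK : j ≤ K) :
    A N K M r j =
      A N K M r (j + 1) + (K - 1).choose (j - 1) * segmentDensity N K M r (j - 1) := by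
  rw [A_eq_sum_segmentDensity hj, A_eq_sum_segmentDensity (Nat.le_add_left 1 j),
    ← add_sum_Ioc_eq_sum_Icc hjK, Icc_add_one_left_eq_Ioc]
  ring

theorem A_antitone (hM0 : 0 ≤ M) (hMN : M ≤ N) (hr : 1 ≤ r) : Antitone (A N K M r) := by
  intro x y hxy
  have h0 := q_nonneg (N := N) hM0 hr
  have h1 := sub_nonneg.2 (q_le_one hMN hr)
  unfold A
  gcongr

theorem A_one (hK : 1 ≤ K) (hr : 1 ≤ r) : A N K M r 1 = r := by
  have hbinom : ∑ j ∈ Icc 1 K, ((K - 1).choose (j - 1) : ℝ) * segmentDensity N K M r (j - 1) =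
      r * (1 - q N M r) * (q N M r + (1 - q N M r)) ^ (K - 1) := by
    rw [add_pow, mul_sum, ← Ico_add_one_right_eq_Icc, sum_Ico_eq_sum_range]
    refine sum_congr (by rw [Nat.sub_add_cancel hK, Nat.add_sub_cancel]) fun j hj => ?_
    have hj := mem_range.1 hj
    rw [segmentDensity, Nat.add_sub_cancel_left, show K - j = K - 1 - j + 1 by lia]
    ring
  rw [A_eq_sum_segmentDensity le_rfl, hbinom, ← mul_q hr]
  ring

theorem existsUnique_isThreshold (hK : 1 ≤ K) (hM0 : 0 ≤ M) (hMN : M < N) (hr : 1 ≤ r) :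
    ∃! s, IsThreshold N K M r s := by
  classical
  have hanti := A_antitone (K := K) hM0 hMN.le hr
  have hlast : A N K M r (K + 1) < 1 := by
    rw [A_last, div_lt_one (hM0.trans_lt hMN)]
    exact hMN
  have hex : ∃ x, A N K M r (x + 1) < 1 := ⟨K, hlast⟩
  have hpos : 1 ≤ Nat.find hex := by
    rw [Nat.one_le_iff_ne_zero]
    intro h0
    have h := Nat.find_spec hex
    rw [h0, zero_add, A_one hK hr] at h
    exact h.not_ge hr
  refine ⟨Nat.find hex, ⟨hpos, Nat.find_min' hex hlast, Nat.find_spec hex, ?_⟩, ?_⟩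
  · have h := Nat.find_min hex (Nat.sub_one_lt_of_lt hpos)
    rw [Nat.sub_add_cancel hpos] at h
    exact not_lt.1 h
  · rintro s ⟨-, -, hs, hs'⟩
    refine le_antisymm (not_lt.1 fun hlt => ?_) (Nat.find_min' hex hs)
    exact (Nat.find_spec hex).not_ge (hs'.trans (hanti (Nat.succ_le_of_lt hlt)))

end Threshold

section Code

open Polynomial in
/-- The Reed–Solomon encoder: the message gives the coefficients of a polynomial of degree `< m`,
which is evaluated at the points `x`. -/
noncomputable def reedSolomonCode {𝔽 : Type} [Field 𝔽] {n : ℕ} (x : Fin n ↪ 𝔽) (m : ℕ) :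
    (Fin m → 𝔽) →ₗ[𝔽] (Fin n → 𝔽) :=
  LinearMap.pi fun t =>
    leval (x t) ∘ₗ (degreeLT 𝔽 m).subtype ∘ₗ (degreeLTEquiv 𝔽 m).symm.toLinearMap

open Polynomial in
theorem isMDS_reedSolomonCode {𝔽 : Type} [Field 𝔽] {m n : ℕ} (x : Fin n ↪ 𝔽) (h : m ≤ n) :
    IsMDS (reedSolomonCode x m) := by
  refine ⟨h, fun T hT w w' hw => ?_⟩
  have hdeg (v : Fin m → 𝔽) : ((degreeLTEquiv 𝔽 m).symm v : 𝔽[X]).degree < #T := by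
    rw [hT]
    exact mem_degreeLT.1 (Subtype.coe_prop _)
  exact (degreeLTEquiv 𝔽 m).symm.injective <| Subtype.ext <|
    eq_of_degrees_lt_of_eval_index_eq T x.injective.injOn (hdeg w) (hdeg w')
      (by simpa [reedSolomonCode] using hw)

theorem exists_isMDS {m n : ℕ} (h : m ≤ n) :
    ∃ (𝔽 : Type) (_ : Field 𝔽) (_ : Finite 𝔽) (_ : CharP 𝔽 2)
      (enc : (Fin m → 𝔽) →ₗ[𝔽] (Fin n → 𝔽)), IsMDS enc := by
  have : Fact (Nat.Prime 2) := ⟨Nat.prime_two⟩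
  have hcard : Nat.card (GaloisField 2 (n + 1)) = 2 ^ (n + 1) := GaloisField.card 2 _ (by lia)
  have hfin : Finite (GaloisField 2 (n + 1)) :=
    Nat.finite_of_card_ne_zero (by rw [hcard]; positivity)
  have : Fintype (GaloisField 2 (n + 1)) := Fintype.ofFinite _
  obtain ⟨x⟩ : Nonempty (Fin n ↪ GaloisField 2 (n + 1)) := by
    apply Function.Embedding.nonempty_of_card_le
    rw [Fintype.card_fin, ← Nat.card_eq_fintype_card, hcard]
    exact (Nat.le_succ n).trans Nat.lt_two_pow_self.le
  exact ⟨GaloisField 2 (n + 1), inferInstance, hfin, inferInstance, reedSolomonCode x m,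
    isMDS_reedSolomonCode x h⟩

theorem le_codeLength {r : ℝ} (hr : 1 ≤ r) (F : ℕ) : F ≤ codeLength r F :=
  Nat.le_floor (le_mul_of_one_le_left F.cast_nonneg hr)

theorem cacheShare_le_codeLength {N : ℕ} {M r : ℝ} (hMN : M ≤ N) (hr : 1 ≤ r) (F : ℕ) :
    cacheShare M N F ≤ codeLength r F := by
  refine le_trans (Nat.floor_le_of_le ?_) (le_codeLength hr F)
  refine div_le_of_le_mul₀ (by positivity) (by positivity) ?_
  rw [mul_comm]
  gcongr

theorem sum_card_cache_le {K' N F n : ℕ} {M : ℝ} (hM0 : 0 ≤ M)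
    (ω : Placement K' N n (cacheShare M N F)) (k : Fin K') :
    ((∑ i, (ω k i).1.card : ℕ) : ℝ) ≤ M * F := by
  calc ((∑ i, (ω k i).1.card : ℕ) : ℝ) = N * cacheShare M N F := by
        simp [fun i => (ω k i).2]
    _ ≤ N * (M * F / N) := by gcongr; exact Nat.floor_le (by positivity)
    _ = M * F * (N / N) := mul_div_left_comm ..
    _ ≤ M * F := mul_le_of_le_one_right (by positivity) (div_self_le_one _)

end Code

section Decoding

variable {K N n : ℕ}

section LeaderSet

variable {d : Fin K → Fin N} {U V W : Finset (Fin K)} {k v : Fin K}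

theorem IsLeaderSet.card (hU : IsLeaderSet d U) : #U = #(univ.image d) := by
  rw [← hU.2, card_image_of_injOn hU.1]

theorem IsLeaderSet.exists_mem (hV : IsLeaderSet d V) (k : Fin K) : ∃ v ∈ V, d v = d k :=
  mem_image.1 (hV.2 ▸ mem_image_of_mem d (mem_univ k))

theorem IsLeaderSet.exchange (hV : IsLeaderSet d V) (hv : v ∈ V) (hk : k ∉ V) (hd : d v = d k) :
    IsLeaderSet d (insert k (V.erase v)) := by
  have himg : (insert k (V.erase v)).image d = univ.image d := by
    rw [image_insert, ← hd, ← image_insert, insert_erase hv, hV.2]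
  refine ⟨?_, himg⟩
  rw [← card_image_iff, himg, ← hV.card, card_insert_of_notMem (by simp [hk]),
    card_erase_add_one hv]

open scoped Classical in
theorem filter_isLeaderSet_erase_eq_pair (hk : k ∈ W) (hV : IsLeaderSet d (W.erase k))
    (hv : v ∈ W.erase k) (hd : d v = d k) : {u ∈ W | IsLeaderSet d (W.erase u)} = {k, v} := by
  have hne := ne_of_mem_erase hv
  have hvW := mem_of_mem_erase hv
  ext u
  simp only [mem_filter, mem_insert, mem_singleton]
  refine ⟨fun ⟨_, hu⟩ => ?_, ?_⟩
  · by_contra! h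
    exact hne (hu.1 (mem_coe.2 (mem_erase.2 ⟨h.2.symm, hvW⟩))
      (mem_coe.2 (mem_erase.2 ⟨h.1.symm, hk⟩)) hd)
  · rintro (rfl | rfl)
    · exact ⟨hk, hV⟩
    · have hexch := hV.exchange hv (notMem_erase k W) hd
      rw [erase_right_comm, insert_erase (mem_erase.2 ⟨hne.symm, hk⟩)] at hexch
      exact ⟨hvW, hexch⟩

end LeaderSet

section Message

variable {𝔽 : Type} [AddCommGroup 𝔽]

open scoped Classical in
theorem sum_filter_isLeaderSet_erase_eq_zero (h2 : ∀ x : 𝔽, x + x = 0) (d : Fin K → Fin N)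
    (W : Finset (Fin K)) (x : Fin N → 𝔽) : ∑ k ∈ W with IsLeaderSet d (W.erase k), x (d k) = 0 := by
  by_cases h : ∃ k ∈ W, IsLeaderSet d (W.erase k)
  · obtain ⟨k, hk, hV⟩ := h
    obtain ⟨v, hv, hd⟩ := hV.exists_mem k
    rw [filter_isLeaderSet_erase_eq_pair hk hV hv hd, sum_pair (ne_of_mem_erase hv).symm, hd, h2]
  · push Not at h
    rw [filter_false_of_mem h, sum_empty]

open scoped Classical in
theorem sum_isLeaderSet_sum_sdiff_eq_zero (h2 : ∀ x : 𝔽, x + x = 0) (d : Fin K → Fin N)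
    (B : Finset (Fin K)) (y : Finset (Fin K) → Fin N → 𝔽) :
    ∑ V ∈ B.powerset with IsLeaderSet d V, ∑ k ∈ B \ V, y ((B \ V).erase k) (d k) = 0 := by
  -- The summand of `(V, k)` depends on `V` only through `W = V ∪ {k}`.
  calc ∑ V ∈ B.powerset with IsLeaderSet d V, ∑ k ∈ B \ V, y ((B \ V).erase k) (d k)
    _ = ∑ W ∈ B.powerset, ∑ k ∈ W with IsLeaderSet d (W.erase k), y (B \ W) (d k) := by
        rw [sum_sigma', sum_sigma']
        refine sum_bij' (fun x _ => ⟨insert x.2 x.1, x.2⟩) (fun x _ => ⟨x.1.erase x.2, x.2⟩)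
          ?_ ?_ ?_ ?_ ?_
        all_goals
          rintro ⟨V, k⟩ h
          simp only [mem_sigma, mem_filter, mem_powerset, mem_sdiff] at h
        · simp [insert_subset_iff, h]
        · simp [(erase_subset _ _).trans h.1, h.1 h.2.1, h]
        · simp [h]
        · simp [h]
        · simp only [sdiff_insert]
    _ = 0 := sum_eq_zero fun W _ => sum_filter_isLeaderSet_erase_eq_zero h2 d W _

/-- The `p`-th symbol of the message `⊕_{k ∈ S} W'_{d_k, S \ {k}}` for the users in `S`, where `w`
are the coded files. -/
def message (w : Fin N → Fin n → 𝔽) (Z : Caches K N n) (d : Fin K → Fin N) (p : ℕ)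
    (S : Finset (Fin K)) : 𝔽 :=
  ∑ k ∈ S, paddedSymbol (w (d k)) (segment Z (d k) (S.erase k)) p

open scoped Classical in
theorem message_eq_sum_of_disjoint (h2 : ∀ x : 𝔽, x + x = 0) (w : Fin N → Fin n → 𝔽)
    (Z : Caches K N n) {d : Fin K → Fin N} (p : ℕ) {S U : Finset (Fin K)} (hU : IsLeaderSet d U)
    (hSU : Disjoint S U) :
    message w Z d p S =
      ∑ V ∈ {V ∈ (S ∪ U).powerset | IsLeaderSet d V}.erase U, message w Z d p ((S ∪ U) \ V) := by
  have hUmem : U ∈ {V ∈ (S ∪ U).powerset | IsLeaderSet d V} :=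
    mem_filter.2 ⟨mem_powerset.2 subset_union_right, hU⟩
  have hsum : ∑ V ∈ (S ∪ U).powerset with IsLeaderSet d V, message w Z d p ((S ∪ U) \ V) = 0 :=
    sum_isLeaderSet_sum_sdiff_eq_zero h2 d (S ∪ U) fun B i => paddedSymbol (w i) (segment Z i B) p
  rw [← add_sum_erase _ _ hUmem, union_sdiff_cancel_right hSU] at hsum
  exact (eq_neg_of_add_eq_zero_left hsum).trans (neg_eq_of_add_eq_zero_left (h2 _))

theorem message_eq_of_forall_leader (h2 : ∀ x : 𝔽, x + x = 0) {w w' : Fin N → Fin n → 𝔽}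
    {Z : Caches K N n} {d : Fin K → Fin N} {p : ℕ} {U S : Finset (Fin K)} (hU : IsLeaderSet d U)
    (h : ∀ T : Finset (Fin K), #T = #S → (T ∩ U).Nonempty →
      message w Z d p T = message w' Z d p T) :
    message w Z d p S = message w' Z d p S := by
  classical
  by_cases hS : (S ∩ U).Nonempty
  · exact h S rfl hS
  have hSU : Disjoint S U := disjoint_iff_inter_eq_empty.2 (not_nonempty_iff_eq_empty.1 hS)
  rw [message_eq_sum_of_disjoint h2 w Z p hU hSU, message_eq_sum_of_disjoint h2 w' Z p hU hSU]
  refine sum_congr rfl fun V hV => ?_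
  simp only [mem_erase, mem_filter, mem_powerset] at hV
  obtain ⟨hVU, hVB, hV⟩ := hV
  have hcard : #V = #U := by rw [hU.card, hV.card]
  apply h
  · rw [card_sdiff_of_subset hVB, card_union_of_disjoint hSU, hcard, Nat.add_sub_cancel]
  · obtain ⟨u, hu, huV⟩ := not_subset.1 fun hsub =>
      hVU (eq_of_subset_of_card_le hsub hcard.le).symm
    exact ⟨u, by simp [hu, huV]⟩

end Message

section FirstPositions

/-- The `l` smallest elements of `T`, or all of them if there are fewer: the positions of the
symbols of the segment at the positions `T` that remain after truncation to length `l`. -/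
def firstPositions {α : Type*} [LinearOrder α] (T : Finset α) (l : ℕ) : Finset α :=
  ({p : Fin #T | (p : ℕ) < l} : Finset (Fin #T)).map (T.orderEmbOfFin rfl).toEmbedding

variable {α : Type*} [LinearOrder α]

theorem firstPositions_subset (T : Finset α) (l : ℕ) : firstPositions T l ⊆ T := by
  intro t ht
  obtain ⟨p, -, rfl⟩ := mem_map.1 ht
  exact T.orderEmbOfFin_mem rfl p

theorem card_firstPositions (T : Finset α) (l : ℕ) : #(firstPositions T l) = min l #T := by
  rw [firstPositions, card_map, Fin.card_filter_val_lt, min_comm]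

theorem firstPositions_of_card_le {T : Finset α} {l : ℕ} (h : #T ≤ l) : firstPositions T l = T :=
  eq_of_subset_of_card_le (firstPositions_subset T l) (by rw [card_firstPositions, min_eq_right h])

theorem eqOn_firstPositions_of_paddedSymbol_eq {𝔽 : Type} [Zero 𝔽] {w w' : Fin n → 𝔽}
    {T : Finset (Fin n)} {l : ℕ} (h : ∀ p < l, paddedSymbol w T p = paddedSymbol w' T p) :
    Set.EqOn w w' (firstPositions T l) := by
  intro t ht
  obtain ⟨p, hp, rfl⟩ := mem_map.1 (mem_coe.1 ht)
  simpa [paddedSymbol] using h p (mem_filter.1 hp).2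

theorem paddedSymbol_congr {𝔽 : Type} [Zero 𝔽] {w w' : Fin n → 𝔽} {T : Finset (Fin n)}
    (h : Set.EqOn w w' T) (p : ℕ) : paddedSymbol w T p = paddedSymbol w' T p := by
  unfold paddedSymbol
  split_ifs
  · exact h (T.orderEmbOfFin_mem rfl _)
  · rfl

end FirstPositions

section Known

variable (Z : Caches K N n) (d : Fin K → Fin N)

theorem mem_segment {Z : Caches K N n} {i : Fin N} {B : Finset (Fin K)} {t : Fin n} :
    t ∈ segment Z i B ↔ ∀ k, t ∈ Z k i ↔ k ∈ B := by
  simp [segment]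

theorem segment_disjoint (i : Fin N) {B B' : Finset (Fin K)} (h : B ≠ B') :
    Disjoint (segment Z i B) (segment Z i B') := by
  refine disjoint_left.2 fun t ht ht' => h (ext fun k => ?_)
  rw [← mem_segment.1 ht, mem_segment.1 ht']

theorem segment_disjoint_cache (i : Fin N) {B : Finset (Fin K)} {k : Fin K} (hk : k ∉ B) :
    Disjoint (Z k i) (segment Z i B) :=
  disjoint_left.2 fun _ ht ht' => hk ((mem_segment.1 ht' k).1 ht)

/-- The positions of the symbols of its requested file that user `k` knows after the delivery of the
first `l j` symbols of each message of round `j`. -/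
def knownPositions (l : ℕ → ℕ) (k : Fin K) : Finset (Fin n) :=
  Z k (d k) ∪ ({S : Finset (Fin K) | k ∈ S} : Finset _).biUnion fun S =>
    firstPositions (segment Z (d k) (S.erase k)) (l #S)

theorem sum_min_card_segment_eq_sum_gain (l : ℕ → ℕ) (k : Fin K) :
    ∑ S : Finset (Fin K) with k ∈ S, min (l #S) #(segment Z (d k) (S.erase k)) =
      ∑ j ∈ Icc 1 K, gain Z d j (l j) k := by
  rw [← sum_fiberwise_of_maps_to (t := Icc 1 K) (g := Finset.card)]
  · refine sum_congr rfl fun j _ => sum_congr ?_ fun S hS => ?_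
    · ext S
      simp [and_comm, mem_powersetCard]
    · simp only [mem_filter, mem_powersetCard] at hS
      rw [hS.1.2]
  · intro S hS
    exact mem_Icc.2 ⟨card_pos.2 ⟨k, (mem_filter.1 hS).2⟩, card_finset_fin_le S⟩

theorem card_knownPositions (l : ℕ → ℕ) (k : Fin K) :
    #(knownPositions Z d l k) = #(Z k (d k)) + ∑ j ∈ Icc 1 K, gain Z d j (l j) k := by
  rw [knownPositions, card_union_of_disjoint, card_biUnion]
  · simp only [card_firstPositions, sum_min_card_segment_eq_sum_gain]
  · intro S hS S' hS' hne
    simp only [coe_filter, mem_univ, true_and, Set.mem_ofPred_eq] at hS hS'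
    refine Disjoint.mono (firstPositions_subset _ _) (firstPositions_subset _ _)
      (segment_disjoint _ _ fun h => hne ?_)
    rw [← insert_erase hS, ← insert_erase hS', h]
  · exact (disjoint_biUnion_right _ _ _).2 fun S _ =>
      (segment_disjoint_cache Z _ (notMem_erase k S)).mono_right (firstPositions_subset _ _)

theorem card_segment_le_seg {S : Finset (Fin K)} {k : Fin K} (hk : k ∈ S) :
    #(segment Z (d k) (S.erase k)) ≤ seg Z d #S :=
  (le_sup (f := fun k => #(segment Z (d k) (S.erase k))) hk).trans
    (le_sup (f := fun S => S.sup fun k => #(segment Z (d k) (S.erase k)))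
      (mem_powersetCard.2 ⟨subset_univ S, rfl⟩))

theorem roundLength_spec (F j : ℕ) (acc : Fin K → ℕ) :
    seg Z d j ≤ roundLength Z d F j acc ∨
      ∀ k, F ≤ acc k + gain Z d j (roundLength Z d F j acc) k :=
  Nat.sInf_mem (s := {l | seg Z d j ≤ l ∨ ∀ k, F ≤ acc k + gain Z d j l k}) ⟨_, Or.inl le_rfl⟩

variable (F : ℕ)

theorem accAfter_succ {m : ℕ} (hm : m ≤ K) (k : Fin K) :
    accAfter Z d F (m + 1) k =
      accAfter Z d F m k + gain Z d (K - m) (incr Z d F (K - m)) k := by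
  rw [accAfter, incr, Nat.sub_sub_self hm]

theorem accAfter_eq_sum {m : ℕ} (hm : m ≤ K) (k : Fin K) :
    accAfter Z d F m k =
      #(Z k (d k)) + ∑ j ∈ Icc (K - m + 1) K, gain Z d j (incr Z d F j) k := by
  induction m with
  | zero => simp [accAfter]
  | succ m ih =>
    rw [accAfter_succ Z d F (by lia), ih (by lia), show K - (m + 1) + 1 = K - m by lia,
      ← add_sum_Ioc_eq_sum_Icc (Nat.sub_le K m), Icc_add_one_left_eq_Ioc]
    ring

theorem accAfter_mono (k : Fin K) : Monotone fun m => accAfter Z d F m k :=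
  monotone_nat_of_le_succ fun _ => Nat.le_add_right _ _

theorem card_knownPositions_incr (k : Fin K) :
    #(knownPositions Z d (incr Z d F) k) = accAfter Z d F K k := by
  rw [card_knownPositions, accAfter_eq_sum Z d F le_rfl, Nat.sub_self, zero_add]

theorem seg_le_incr_or_le_accAfter {j : ℕ} (hjK : j ≤ K) :
    seg Z d j ≤ incr Z d F j ∨ ∀ k, F ≤ accAfter Z d F (K - j + 1) k := by
  simpa only [accAfter_succ Z d F (Nat.sub_le K j), Nat.sub_sub_self hjK, incr] using
    roundLength_spec Z d F j (accAfter Z d F (K - j))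

variable {Z d} in
theorem knownPositions_eq_univ {l : ℕ → ℕ} (hl : ∀ j ∈ Icc 1 K, seg Z d j ≤ l j) (k : Fin K) :
    knownPositions Z d l k = univ := by
  refine eq_univ_of_forall fun t => ?_
  by_cases ht : t ∈ Z k (d k)
  · exact mem_union_left _ ht
  let B : Finset (Fin K) := {k' | t ∈ Z k' (d k)}
  have hkB : k ∉ B := by simpa [B] using ht
  have hround : #(insert k B) ∈ Icc 1 K :=
    mem_Icc.2 ⟨card_pos.2 (insert_nonempty k B), card_finset_fin_le _⟩
  refine mem_union_right _ (mem_biUnion.2 ⟨insert k B, by simp, ?_⟩)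
  rw [firstPositions_of_card_le
    ((card_segment_le_seg Z d (mem_insert_self k B)).trans (hl _ hround)), erase_insert hkB]
  simp [mem_segment, B]

theorem le_card_knownPositions {F : ℕ} (hF : F ≤ n) (k : Fin K) :
    F ≤ #(knownPositions Z d (incr Z d F) k) := by
  by_cases h : ∃ j ∈ Icc 1 K, ∀ k, F ≤ accAfter Z d F (K - j + 1) k
  · obtain ⟨j, hj, h⟩ := h
    have hj := mem_Icc.1 hj
    rw [card_knownPositions_incr]
    exact (h k).trans (accAfter_mono Z d F k (by lia))
  · push Not at h
    have hfull (j) (hj : j ∈ Icc 1 K) : seg Z d j ≤ incr Z d F j :=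
      (seg_le_incr_or_le_accAfter Z d F (mem_Icc.1 hj).2).resolve_right fun hF =>
        let ⟨k', hk'⟩ := h j hj
        (hF k').not_gt hk'
    rw [knownPositions_eq_univ hfull k, card_univ, Fintype.card_fin]
    exact hF

end Known

section Decode

variable {𝔽 : Type} [AddCommGroup 𝔽] {Z : Caches K N n} {d : Fin K → Fin N} {k : Fin K}

theorem paddedSymbol_eq_of_message_eq {w w' : Fin N → Fin n → 𝔽} {p : ℕ} {S : Finset (Fin K)}
    (hk : k ∈ S) (hcache : ∀ i, Set.EqOn (w i) (w' i) (Z k i))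
    (hmsg : message w Z d p S = message w' Z d p S) :
    paddedSymbol (w (d k)) (segment Z (d k) (S.erase k)) p =
      paddedSymbol (w' (d k)) (segment Z (d k) (S.erase k)) p := by
  have hothers : ∀ k' ∈ S.erase k,
      paddedSymbol (w (d k')) (segment Z (d k') (S.erase k')) p =
        paddedSymbol (w' (d k')) (segment Z (d k') (S.erase k')) p := by
    intro k' hk'
    refine paddedSymbol_congr (fun t ht => hcache (d k') ?_) p
    exact (mem_segment.1 ht k).2 (mem_erase.2 ⟨(ne_of_mem_erase hk').symm, hk⟩)
  rw [message, message, ← add_sum_erase _ _ hk, ← add_sum_erase _ _ hk, sum_congr rfl hothers]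
    at hmsg
  exact add_right_cancel hmsg

variable {F : ℕ} {enc : (Fin F → 𝔽) → (Fin n → 𝔽)} {U : Finset (Fin K)} {W W' : Fin N → Fin F → 𝔽}

theorem message_eq_of_transmission_eq (h2 : ∀ x : 𝔽, x + x = 0) (hU : IsLeaderSet d U)
    (h : transmission enc Z d U W = transmission enc Z d U W') {S : Finset (Fin K)} {p : ℕ}
    (hp : p < incr Z d F #S) :
    message (fun i => enc (W i)) Z d p S = message (fun i => enc (W' i)) Z d p S :=
  message_eq_of_forall_leader h2 hU fun T hT hTU =>
    congrFun h ⟨⟨T, p⟩, by simp [sent, hTU, hT, hp]⟩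

theorem eqOn_knownPositions (h2 : ∀ x : 𝔽, x + x = 0) (hU : IsLeaderSet d U)
    (hcache : cacheContent enc Z k W = cacheContent enc Z k W')
    (htrans : transmission enc Z d U W = transmission enc Z d U W') :
    Set.EqOn (enc (W (d k))) (enc (W' (d k))) (knownPositions Z d (incr Z d F) k) := by
  have hcache' : ∀ i, Set.EqOn (enc (W i)) (enc (W' i)) (Z k i) := fun i t hti =>
    congrFun (congrFun hcache i) ⟨t, hti⟩
  intro t ht
  simp only [knownPositions, coe_union, coe_biUnion, Set.mem_union, Set.mem_iUnion] at ht
  obtain ht | ⟨S, hS, ht⟩ := ht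
  · exact hcache' _ ht
  · refine eqOn_firstPositions_of_paddedSymbol_eq (fun p hp => ?_) ht
    exact paddedSymbol_eq_of_message_eq (w := fun i => enc (W i)) (w' := fun i => enc (W' i))
      (mem_filter.1 hS).2 hcache' (message_eq_of_transmission_eq h2 hU htrans hp)

theorem canDecode (h2 : ∀ x : 𝔽, x + x = 0) (henc : IsMDS enc) (Z : Caches K N n)
    (hU : IsLeaderSet d U) (k : Fin K) : CanDecode enc Z d U k := by
  have hfactor : Function.FactorsThrough (fun W : Fin N → Fin F → 𝔽 => W (d k))
      (fun W => (cacheContent enc Z k W, transmission enc Z d U W)) := by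
    intro W W' h
    obtain ⟨hcache, htrans⟩ := Prod.mk.inj h
    obtain ⟨T, hT, hTF⟩ := exists_subset_card_eq (le_card_knownPositions Z d henc.1 k)
    exact henc.2 T hTF _ _ fun t ht => eqOn_knownPositions h2 hU hcache htrans (hT ht)
  obtain ⟨dec, hdec⟩ := (Function.factorsThrough_iff _).1 hfactor
  exact ⟨fun c x => dec (c, x), fun W => (congrFun hdec W).symm⟩

end Decode

end Decoding

section Stability

variable {K N n : ℕ}

section Round

variable (Z : Caches K N n) (d : Fin K → Fin N) {j : ℕ}

theorem card_filter_mem_powersetCard (k : Fin K) (hj : 1 ≤ j) :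
    #{S ∈ powersetCard j (univ : Finset (Fin K)) | k ∈ S} = (K - 1).choose (j - 1) := by
  simpa using card_filter_powersetCard_subset {k} univ j (subset_univ _) (by simpa using hj)

theorem gain_le (hj : 1 ≤ j) (l : ℕ) (k : Fin K) :
    gain Z d j l k ≤ (K - 1).choose (j - 1) * l := by
  rw [gain, ← card_filter_mem_powersetCard k hj, ← smul_eq_mul]
  exact sum_le_card_nsmul _ _ _ fun S _ => min_le_left _ _

variable {Z d}

theorem gain_eq_of_le_card_segment (hj : 1 ≤ j) {l : ℕ}
    (hl : ∀ S : Finset (Fin K), #S = j → ∀ k ∈ S, l ≤ #(segment Z (d k) (S.erase k)))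
    (k : Fin K) : gain Z d j l k = (K - 1).choose (j - 1) * l := by
  rw [gain, ← card_filter_mem_powersetCard k hj, ← smul_eq_mul, ← sum_const]
  refine sum_congr rfl fun S hS => ?_
  rw [mem_filter, mem_powersetCard] at hS
  exact min_eq_left (hl S hS.1.2 k hS.2)

variable {δ g : ℝ}
  (hg : ∀ S : Finset (Fin K), #S = j → ∀ k ∈ S, |(#(segment Z (d k) (S.erase k)) : ℝ) - g| ≤ δ)
include hg

theorem abs_gain_sub_le (hj : 1 ≤ j) (l : ℕ) (k : Fin K) :
    |(gain Z d j l k : ℝ) - (K - 1).choose (j - 1) * min (l : ℝ) g| ≤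
      (K - 1).choose (j - 1) * δ := by
  have hsum : (gain Z d j l k : ℝ) - (K - 1).choose (j - 1) * min (l : ℝ) g =
      ∑ S ∈ powersetCard j univ with k ∈ S,
        (min (l : ℝ) #(segment Z (d k) (S.erase k)) - min (l : ℝ) g) := by
    rw [sum_sub_distrib, sum_const, card_filter_mem_powersetCard k hj, gain, nsmul_eq_mul]
    push_cast
    rfl
  rw [hsum, ← card_filter_mem_powersetCard k hj, ← nsmul_eq_mul]
  refine (abs_sum_le_sum_abs _ _).trans (sum_le_card_nsmul _ _ _ fun S hS => ?_)
  rw [mem_filter, mem_powersetCard] at hS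
  have hSk := hg S hS.1.2 k hS.2
  refine (abs_min_sub_min_le_max _ _ _ _).trans (max_le ?_ hSk)
  rw [sub_self, abs_zero]
  exact (abs_nonneg _).trans hSk

theorem seg_le_add (hg0 : 0 ≤ g) (hδ : 0 ≤ δ) : (seg Z d j : ℝ) ≤ g + δ := by
  refine (Nat.le_floor_iff (by positivity)).1 ?_
  refine Finset.sup_le fun S hS => Finset.sup_le fun k hk => ?_
  exact Nat.le_floor (sub_le_iff_le_add'.1 (abs_le.1 (hg S (mem_powersetCard.1 hS).2 k hk)).2)

theorem sub_le_seg (hj : 1 ≤ j) (hjK : j ≤ K) : g - δ ≤ seg Z d j := by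
  obtain ⟨S, -, rfl⟩ := exists_subset_card_eq (s := (univ : Finset (Fin K))) (by simpa using hjK)
  obtain ⟨k, hk⟩ := card_pos.1 hj
  have hle : (#(segment Z (d k) (S.erase k)) : ℝ) ≤ seg Z d #S :=
    Nat.cast_le.2 (card_segment_le_seg Z d hk)
  linarith [(abs_le.1 (hg S rfl k hk)).1]

variable {F : ℕ} {a : ℝ} {acc : Fin K → ℕ} (hacc : ∀ k, |(acc k : ℝ) - a| ≤ δ)
include hacc

theorem min_le_roundLength_add (hj : 1 ≤ j) (hjK : j ≤ K) (hδ : 0 ≤ δ) :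
    min g ((F - a) / (K - 1).choose (j - 1)) ≤ roundLength Z d F j acc + δ := by
  have hC : (1 : ℝ) ≤ (K - 1).choose (j - 1) := by
    exact_mod_cast Nat.choose_pos (by lia : j - 1 ≤ K - 1)
  obtain hfull | hdone := roundLength_spec Z d F j acc
  · have hseg : (seg Z d j : ℝ) ≤ roundLength Z d F j acc := Nat.cast_le.2 hfull
    exact (min_le_left _ _).trans (by linarith [sub_le_seg hg hj hjK])
  · let k : Fin K := ⟨0, hj.trans hjK⟩
    have hF : (F : ℝ) ≤ acc k + (K - 1).choose (j - 1) * roundLength Z d F j acc := by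
      exact_mod_cast (hdone k).trans (Nat.add_le_add_left (gain_le Z d hj _ k) _)
    refine (min_le_right _ _).trans ((div_le_iff₀' (by positivity)).2 ?_)
    rw [mul_add]
    linarith [(abs_le.1 (hacc k)).2, le_mul_of_one_le_left hδ hC]

theorem roundLength_le_div_add (hj : 1 ≤ j) (hjK : j ≤ K) (hδ : 0 ≤ δ) (hg0 : 0 ≤ g) (ha : a ≤ F) :
    (roundLength Z d F j acc : ℝ) ≤ (F - a) / (K - 1).choose (j - 1) + 3 * δ + 1 := by
  have hC : (1 : ℝ) ≤ (K - 1).choose (j - 1) := by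
    exact_mod_cast Nat.choose_pos (by lia : j - 1 ≤ K - 1)
  set β : ℝ := (F - a) / (K - 1).choose (j - 1)
  have : 0 ≤ β := div_nonneg (sub_nonneg.2 ha) (by positivity)
  have hCβ : (K - 1).choose (j - 1) * β = F - a := mul_div_cancel₀ _ (by positivity)
  have hceil : (⌈β + δ⌉₊ : ℝ) < β + δ + 1 := Nat.ceil_lt_add_one (by positivity)
  by_cases hlong : ∀ S : Finset (Fin K), #S = j → ∀ k ∈ S,
      ⌈β + δ⌉₊ ≤ #(segment Z (d k) (S.erase k))
  · have hdone (k : Fin K) : F ≤ acc k + gain Z d j ⌈β + δ⌉₊ k := by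
      rw [gain_eq_of_le_card_segment hj hlong]
      have hmul : (K - 1).choose (j - 1) * (β + δ) ≤
          ((K - 1).choose (j - 1) : ℝ) * ⌈β + δ⌉₊ := by gcongr; exact Nat.le_ceil _
      rify
      linarith [(abs_le.1 (hacc k)).1, le_mul_of_one_le_left hδ hC]
    have hle : (roundLength Z d F j acc : ℝ) ≤ ⌈β + δ⌉₊ := Nat.cast_le.2 (Nat.sInf_le (.inr hdone))
    linarith
  · -- A segment shorter than `⌈β + δ⌉` bounds `g`, hence all segments, by about `β`.
    push Not at hlong
    obtain ⟨S, hS, k, hk, hlt⟩ := hlong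
    have hlt : (#(segment Z (d k) (S.erase k)) : ℝ) < ⌈β + δ⌉₊ := Nat.cast_lt.2 hlt
    have hle : (roundLength Z d F j acc : ℝ) ≤ seg Z d j :=
      Nat.cast_le.2 (Nat.sInf_le (.inl le_rfl))
    linarith [seg_le_add hg hg0 hδ, (abs_le.1 (hg S hS k hk)).1]

theorem abs_roundLength_sub_le (hj : 1 ≤ j) (hjK : j ≤ K) (hδ : 1 ≤ δ) (hg0 : 0 ≤ g)
    (ha : a ≤ F) :
    |(roundLength Z d F j acc : ℝ) - min g ((F - a) / (K - 1).choose (j - 1))| ≤ 4 * δ := by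
  have hδ0 : 0 ≤ δ := zero_le_one.trans hδ
  have hle : (roundLength Z d F j acc : ℝ) ≤ seg Z d j :=
    Nat.cast_le.2 (Nat.sInf_le (.inl le_rfl))
  rw [abs_sub_le_iff, sub_le_comm]
  constructor
  · exact le_min (by linarith [seg_le_add hg hg0 hδ0])
      (by linarith [roundLength_le_div_add hg hacc hj hjK hδ0 hg0 ha])
  · linarith [min_le_roundLength_add (F := F) hg hacc hj hjK hδ0]

theorem abs_gain_roundLength_sub_le (hj : 1 ≤ j) (hjK : j ≤ K) (hδ : 1 ≤ δ) (hg0 : 0 ≤ g)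
    (ha : a ≤ F) (k : Fin K) :
    |(gain Z d j (roundLength Z d F j acc) k : ℝ) -
        (K - 1).choose (j - 1) * min g ((F - a) / (K - 1).choose (j - 1))| ≤
      5 * (K - 1).choose (j - 1) * δ := by
  set C : ℝ := ((K - 1).choose (j - 1) : ℝ)
  set β := min g ((F - a) / C)
  have hgain := abs_gain_sub_le hg hj (roundLength Z d F j acc) k
  have hmin : |min (roundLength Z d F j acc : ℝ) g - β| ≤ 4 * δ := by
    have h := abs_min_sub_min_le_max (roundLength Z d F j acc : ℝ) g β g
    rw [min_eq_left (min_le_left _ _ : β ≤ g), sub_self, abs_zero,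
      max_eq_left (abs_nonneg _)] at h
    exact h.trans (abs_roundLength_sub_le hg hacc hj hjK hδ hg0 ha)
  calc |(gain Z d j (roundLength Z d F j acc) k : ℝ) - C * β|
    _ ≤ |(gain Z d j (roundLength Z d F j acc) k : ℝ) - C * min (roundLength Z d F j acc : ℝ) g| +
          |C * min (roundLength Z d F j acc : ℝ) g - C * β| := abs_sub_le _ _ _
    _ ≤ C * δ + C * (4 * δ) := by
        rw [← mul_sub, abs_mul, abs_of_nonneg (by positivity : 0 ≤ C)]
        gcongr
    _ = 5 * C * δ := by ring

end Round

section Limit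

variable {M r : ℝ}

/-- The idealised length, in units of `F`, of the messages of round `j`: the segments are sent
entirely as long as they do not exceed what the users, who by then have `F * min 1 A(j+1)` symbols,
still need. -/
noncomputable def limitLength (N K : ℕ) (M r : ℝ) (j : ℕ) : ℝ :=
  min (segmentDensity N K M r (j - 1))
    ((1 - min 1 (A N K M r (j + 1))) / (K - 1).choose (j - 1))

theorem limitLength_nonneg (hM0 : 0 ≤ M) (hMN : M ≤ N) (hr : 1 ≤ r) (j : ℕ) :
    0 ≤ limitLength N K M r j :=
  le_min (segmentDensity_nonneg hM0 hMN hr _)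
    (div_nonneg (sub_nonneg.2 (min_le_left _ _)) (Nat.cast_nonneg _))

theorem mul_limitLength {j : ℕ} (hj : 1 ≤ j) (hjK : j ≤ K) (hM0 : 0 ≤ M) (hMN : M ≤ N)
    (hr : 1 ≤ r) :
    (K - 1).choose (j - 1) * limitLength N K M r j =
      min 1 (A N K M r j) - min 1 (A N K M r (j + 1)) := by
  have hC : (0 : ℝ) < (K - 1).choose (j - 1) := by
    exact_mod_cast Nat.choose_pos (by lia : j - 1 ≤ K - 1)
  have hstep := A_eq_add (N := N) (M := M) (r := r) hj hjK
  have hanti : A N K M r (j + 1) ≤ A N K M r j := A_antitone hM0 hMN hr j.le_succ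
  rw [limitLength, mul_min_of_nonneg _ _ hC.le, mul_div_cancel₀ _ hC.ne']
  rcases le_total 1 (A N K M r (j + 1)) with h | h
  · rw [min_eq_left h, min_eq_left (h.trans hanti), sub_self, min_eq_right (by linarith)]
  · rw [min_eq_right h, min_comm 1, ← min_sub_sub_right, hstep, add_sub_cancel_left]

theorem limitLength_eq_segmentDensity {s j : ℕ} (hs : IsThreshold N K M r s) (hsj : s < j)
    (hjK : j ≤ K) (hM0 : 0 ≤ M) (hMN : M ≤ N) (hr : 1 ≤ r) :
    limitLength N K M r j = segmentDensity N K M r (j - 1) := by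
  have hj : 1 ≤ j := hs.1.trans hsj.le
  have hanti := A_antitone (K := K) hM0 hMN hr
  have hC : ((K - 1).choose (j - 1) : ℝ) ≠ 0 := by
    exact_mod_cast (Nat.choose_pos (by lia : j - 1 ≤ K - 1)).ne'
  have hA : A N K M r j ≤ 1 := (hanti hsj).trans hs.2.2.1.le
  refine mul_left_cancel₀ hC ?_
  rw [mul_limitLength hj hjK hM0 hMN hr, min_eq_right hA, min_eq_right ((hanti j.le_succ).trans hA),
    A_eq_add hj hjK, add_sub_cancel_left]

theorem limitLength_threshold {s : ℕ} (hs : IsThreshold N K M r s) (hM0 : 0 ≤ M) (hMN : M ≤ N)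
    (hr : 1 ≤ r) :
    limitLength N K M r s = (1 - A N K M r (s + 1)) / (K - 1).choose (s - 1) := by
  have hC : ((K - 1).choose (s - 1) : ℝ) ≠ 0 := by
    exact_mod_cast (Nat.choose_pos (Nat.sub_le_sub_right hs.2.1 1)).ne'
  rw [eq_div_iff hC, mul_comm, mul_limitLength hs.1 hs.2.1 hM0 hMN hr, min_eq_left hs.2.2.2,
    min_eq_right hs.2.2.1.le]

theorem limitLength_eq_zero {s j : ℕ} (hs : IsThreshold N K M r s) (hjs : j < s) (hM0 : 0 ≤ M)
    (hMN : M ≤ N) (hr : 1 ≤ r) : limitLength N K M r j = 0 := by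
  have hA : 1 ≤ A N K M r (j + 1) := hs.2.2.2.trans (A_antitone hM0 hMN hr hjs)
  rw [limitLength, min_eq_left hA, sub_self, zero_div,
    min_eq_right (segmentDensity_nonneg hM0 hMN hr _)]

/-- The idealised rate, in units of `F`, when `J` different files are requested. -/
noncomputable def limitRate (N K : ℕ) (M r : ℝ) (J : ℕ) : ℝ :=
  ∑ j ∈ Icc 1 K, limitLength N K M r j * (K.choose j - (K - J).choose j)

theorem limitRate_mono (hM0 : 0 ≤ M) (hMN : M ≤ N) (hr : 1 ≤ r) :
    Monotone (limitRate N K M r) := fun _ _ hJ =>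
  sum_le_sum fun j _ => mul_le_mul_of_nonneg_left
    (sub_le_sub_left (Nat.cast_le.2 (Nat.choose_le_choose j (Nat.sub_le_sub_left hJ K))) _)
    (limitLength_nonneg hM0 hMN hr j)

theorem limitRate_min_eq_Rdec {s : ℕ} (hs : IsThreshold N K M r s) (hM0 : 0 ≤ M) (hMN : M ≤ N)
    (hr : 1 ≤ r) : limitRate N K M r (min N K) = Rdec N K M r s := by
  have hbelow : ∀ j ∈ Icc 1 K, j ∉ Icc s K →
      limitLength N K M r j * ((K.choose j : ℝ) - (K - min N K).choose j) = 0 := by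
    intro j hj hjs
    rw [mem_Icc] at hj hjs
    rw [limitLength_eq_zero hs (by lia) hM0 hMN hr, zero_mul]
  rw [limitRate, ← sum_subset (Icc_subset_Icc_left hs.1) hbelow, ← add_sum_Ioc_eq_sum_Icc hs.2.1,
    ← Icc_add_one_left_eq_Ioc, add_comm, Rdec, limitLength_threshold hs hM0 hMN hr]
  congr 1
  refine sum_congr rfl fun j hj => ?_
  obtain ⟨hsj, hjK⟩ := mem_Icc.1 hj
  rw [limitLength_eq_segmentDensity hs hsj hjK hM0 hMN hr, segmentDensity,
    show K - (j - 1) = K - j + 1 by lia]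

end Limit

section Balanced

variable {M r δ : ℝ} {F : ℕ} {Z : Caches K N n}

/-- All caches and all segments have their idealised size up to `δ` symbols. -/
def IsBalanced (M r : ℝ) (F : ℕ) (δ : ℝ) (Z : Caches K N n) : Prop :=
  (∀ k i, |(#(Z k i) : ℝ) - F * (M / N)| ≤ δ) ∧
    ∀ i B, |(#(segment Z i B) : ℝ) - F * segmentDensity N K M r #B| ≤ δ

theorem IsBalanced.abs_card_segment_erase_sub_le (hZ : IsBalanced M r F δ Z) (d : Fin K → Fin N)
    {j : ℕ} {S : Finset (Fin K)} (hS : #S = j) {k : Fin K} (hk : k ∈ S) :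
    |(#(segment Z (d k) (S.erase k)) : ℝ) - F * segmentDensity N K M r (j - 1)| ≤ δ := by
  simpa only [card_erase_of_mem hk, hS] using hZ.2 (d k) (S.erase k)

theorem mul_limitLength_eq_min (j : ℕ) :
    F * limitLength N K M r j = min (F * segmentDensity N K M r (j - 1))
      ((F - F * min 1 (A N K M r (j + 1))) / (K - 1).choose (j - 1)) := by
  rw [limitLength, mul_min_of_nonneg _ _ (Nat.cast_nonneg F), ← mul_div_assoc, mul_sub, mul_one]

/-- The factor by which one round can amplify the deviation from the idealised symbol counts. -/
def deviationFactor (K : ℕ) : ℝ := 1 + 5 * 2 ^ K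

theorem one_le_deviationFactor_pow (K m : ℕ) : 1 ≤ deviationFactor K ^ m :=
  one_le_pow₀ (by unfold deviationFactor; norm_num)

section
variable (hZ : IsBalanced M r F δ Z) (hM0 : 0 ≤ M) (hMN : M ≤ N) (hr : 1 ≤ r) (hδ : 1 ≤ δ)
include hZ hM0 hMN hr hδ

theorem IsBalanced.abs_accAfter_sub_le (d : Fin K → Fin N) {m : ℕ} (hm : m ≤ K) (k : Fin K) :
    |(accAfter Z d F m k : ℝ) - F * min 1 (A N K M r (K - m + 1))| ≤
      deviationFactor K ^ m * δ := by
  induction m generalizing k with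
  | zero =>
    rw [Nat.sub_zero, A_last, min_eq_right (div_le_one_of_le₀ hMN N.cast_nonneg), pow_zero, one_mul]
    exact hZ.1 k (d k)
  | succ m ih =>
    have hjK : K - m ≤ K := Nat.sub_le K m
    have hj : 1 ≤ K - m := Nat.sub_pos_of_lt hm
    set η := deviationFactor K ^ m * δ with hη
    have hδη : δ ≤ η := le_mul_of_one_le_left (by positivity) (one_le_deviationFactor_pow K m)
    have hη0 : 0 ≤ η := (zero_le_one.trans hδ).trans hδη
    have hgain := abs_gain_roundLength_sub_le (F := F) (a := F * min 1 (A N K M r (K - m + 1)))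
      (fun S hS k hk => (hZ.abs_card_segment_erase_sub_le d hS hk).trans hδη) (ih (by lia)) hj hjK
      (hδ.trans hδη) (mul_nonneg F.cast_nonneg (segmentDensity_nonneg hM0 hMN hr _))
      (mul_le_of_le_one_right F.cast_nonneg (min_le_left _ _)) k
    rw [← mul_limitLength_eq_min] at hgain
    have hchoose : ((K - 1).choose (K - m - 1) : ℝ) ≤ 2 ^ K := by
      exact_mod_cast (Nat.choose_le_two_pow _ _).trans (Nat.pow_le_pow_right two_pos K.pred_le)
    calc |(accAfter Z d F (m + 1) k : ℝ) - F * min 1 (A N K M r (K - (m + 1) + 1))|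
      _ = |(accAfter Z d F m k - F * min 1 (A N K M r (K - m + 1))) +
            (gain Z d (K - m) (roundLength Z d F (K - m) (accAfter Z d F m)) k -
              (K - 1).choose (K - m - 1) * (F * limitLength N K M r (K - m)))| := by
          rw [accAfter, show K - (m + 1) + 1 = K - m by lia, mul_left_comm,
            mul_limitLength hj hjK hM0 hMN hr]
          push_cast
          ring_nf
      _ ≤ η + 5 * (K - 1).choose (K - m - 1) * η :=
          (abs_add_le _ _).trans (add_le_add (ih (by lia) k) hgain)
      _ ≤ η + 5 * 2 ^ K * η := by gcongr
      _ = deviationFactor K ^ (m + 1) * δ := by rw [hη, pow_succ, deviationFactor]; ring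

theorem IsBalanced.abs_incr_sub_le (d : Fin K → Fin N) {j : ℕ} (hj : 1 ≤ j) (hjK : j ≤ K) :
    |(incr Z d F j : ℝ) - F * limitLength N K M r j| ≤ 4 * (deviationFactor K ^ K * δ) := by
  have hδη : δ ≤ deviationFactor K ^ K * δ :=
    le_mul_of_one_le_left (by positivity) (one_le_deviationFactor_pow K K)
  have hacc (k : Fin K) : |(accAfter Z d F (K - j) k : ℝ) - F * min 1 (A N K M r (j + 1))| ≤
      deviationFactor K ^ K * δ := by
    have h := hZ.abs_accAfter_sub_le hM0 hMN hr hδ d (Nat.sub_le K j) k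
    rw [Nat.sub_sub_self hjK] at h
    refine h.trans ?_
    gcongr
    · exact pow_one (deviationFactor K) ▸ one_le_deviationFactor_pow K 1
    · exact Nat.sub_le K j
  rw [mul_limitLength_eq_min]
  exact abs_roundLength_sub_le
    (fun S hS k hk => (hZ.abs_card_segment_erase_sub_le d hS hk).trans hδη) hacc hj hjK
    (hδ.trans hδη) (mul_nonneg F.cast_nonneg (segmentDensity_nonneg hM0 hMN hr _))
    (mul_le_of_le_one_right F.cast_nonneg (min_le_left _ _))

end

end Balanced

end Stability

section Load

variable {K N n : ℕ}

theorem card_filter_inter_nonempty (U : Finset (Fin K)) (j : ℕ) :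
    (#{S ∈ powersetCard j (univ : Finset (Fin K)) | (S ∩ U).Nonempty} : ℝ) =
      K.choose j - (K - #U).choose j := by
  have hsplit := card_filter_add_card_filter_not (s := powersetCard j (univ : Finset (Fin K)))
    fun S => (S ∩ U).Nonempty
  have hcompl : {S ∈ powersetCard j (univ : Finset (Fin K)) | ¬ (S ∩ U).Nonempty} =
      powersetCard j Uᶜ := by
    ext S
    simp [mem_powersetCard, not_nonempty_iff_eq_empty, ← disjoint_iff_inter_eq_empty,
      subset_compl_iff_disjoint_right, and_comm]
  rw [hcompl, card_powersetCard, card_powersetCard, card_compl, card_univ, Fintype.card_fin]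
    at hsplit
  rw [← hsplit, Nat.cast_add, add_sub_cancel_right]

theorem load_eq_sum (Z : Caches K N n) (d : Fin K → Fin N) (F : ℕ) (U : Finset (Fin K)) :
    (load Z d F U : ℝ) = ∑ j ∈ Icc 1 K, (incr Z d F j : ℝ) * (K.choose j - (K - #U).choose j) := by
  have hmaps : ∀ S ∈ ({S | (S ∩ U).Nonempty} : Finset (Finset (Fin K))), #S ∈ Icc 1 K :=
    fun S hS => mem_Icc.2
      ⟨card_pos.2 ((mem_filter.1 hS).2.mono inter_subset_left), card_finset_fin_le S⟩
  rw [load, sent, card_sigma, ← sum_fiberwise_of_maps_to hmaps, Nat.cast_sum]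
  refine sum_congr rfl fun j _ => ?_
  have hfiber : ({S | (S ∩ U).Nonempty} : Finset (Finset (Fin K))).filter (fun S => #S = j) =
      {S ∈ powersetCard j (univ : Finset (Fin K)) | (S ∩ U).Nonempty} := by
    ext S
    simp [mem_powersetCard, and_comm]
  rw [hfiber, ← card_filter_inter_nonempty, mul_comm, ← nsmul_eq_mul, ← sum_const, Nat.cast_sum]
  refine sum_congr rfl fun S hS => ?_
  rw [card_range, (mem_powersetCard.1 (mem_filter.1 hS).1).2]

theorem exists_card_image_eq_min (hN : 1 ≤ N) :
    ∃ d : Fin K → Fin N, #(univ.image d) = min N K := by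
  refine ⟨fun k => ⟨min k.1 (N - 1), by lia⟩, ?_⟩
  have himage : (univ.image fun k : Fin K => (⟨min k.1 (N - 1), by lia⟩ : Fin N)) =
      (univ : Finset (Fin (min N K))).image (Fin.castLE (min_le_left N K)) := by
    ext i
    simp only [mem_image, mem_univ, true_and, Fin.ext_iff, Fin.val_castLE]
    constructor
    · rintro ⟨k, hk⟩
      exact ⟨⟨i, by lia⟩, rfl⟩
    · rintro ⟨x, hx⟩
      exact ⟨⟨x, by lia⟩, by simp only; lia⟩
  rw [himage, card_image_of_injective _ (Fin.castLE_injective _), card_univ, Fintype.card_fin]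

theorem card_image_le_min (d : Fin K → Fin N) : #(univ.image d) ≤ min N K :=
  le_min (card_finset_fin_le _) (by simpa using card_image_le (s := univ) (f := d))

variable {M r δ : ℝ} {F s : ℕ} {Z : Caches K N n} (hZ : IsBalanced M r F δ Z)
  (hM0 : 0 ≤ M) (hMN : M ≤ N) (hr : 1 ≤ r) (hδ : 1 ≤ δ)
include hZ hM0 hMN hr hδ

theorem IsBalanced.abs_load_sub_le {d : Fin K → Fin N} {U : Finset (Fin K)}
    (hU : IsLeaderSet d U) :
    |(load Z d F U : ℝ) - F * limitRate N K M r #(univ.image d)| ≤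
      2 ^ K * (4 * (deviationFactor K ^ K * δ)) := by
  set J := #(univ.image d)
  have hbinom : ∑ j ∈ Icc 1 K, ((K.choose j : ℝ) - (K - J).choose j) ≤ 2 ^ K := by
    calc ∑ j ∈ Icc 1 K, ((K.choose j : ℝ) - (K - J).choose j)
      _ ≤ ∑ j ∈ Icc 1 K, (K.choose j : ℝ) := sum_le_sum fun j _ => sub_le_self _ (by positivity)
      _ ≤ ∑ j ∈ range (K + 1), (K.choose j : ℝ) :=
          sum_le_sum_of_subset_of_nonneg (fun j hj => by simp at hj ⊢; lia)
            fun _ _ _ => by positivity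
      _ = 2 ^ K := by exact_mod_cast Nat.sum_range_choose K
  calc |(load Z d F U : ℝ) - F * limitRate N K M r J|
    _ = |∑ j ∈ Icc 1 K, ((incr Z d F j : ℝ) - F * limitLength N K M r j) *
          (K.choose j - (K - J).choose j)| := by
        rw [load_eq_sum, hU.card, limitRate, mul_sum, ← sum_sub_distrib]
        simp only [sub_mul, mul_assoc, J]
    _ ≤ ∑ j ∈ Icc 1 K, 4 * (deviationFactor K ^ K * δ) *
          ((K.choose j : ℝ) - (K - J).choose j) := by
        refine (abs_sum_le_sum_abs _ _).trans (sum_le_sum fun j hj => ?_)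
        obtain ⟨hj, hjK⟩ := mem_Icc.1 hj
        have hnonneg : (0 : ℝ) ≤ K.choose j - (K - J).choose j :=
          sub_nonneg.2 (Nat.cast_le.2 (Nat.choose_le_choose j (Nat.sub_le K J)))
        rw [abs_mul, abs_of_nonneg hnonneg]
        exact mul_le_mul_of_nonneg_right (hZ.abs_incr_sub_le hM0 hMN hr hδ d hj hjK) hnonneg
    _ ≤ 2 ^ K * (4 * (deviationFactor K ^ K * δ)) := by
        have := one_le_deviationFactor_pow K K
        rw [← mul_sum, mul_comm]
        gcongr

theorem IsBalanced.abs_worstRate_sub_le (hN : 1 ≤ N) (hs : IsThreshold N K M r s) (hF : 0 < F)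
    {U : (Fin K → Fin N) → Finset (Fin K)} (hU : ∀ d, IsLeaderSet d (U d)) :
    |worstRate Z F U - Rdec N K M r s| ≤ 2 ^ K * (4 * (deviationFactor K ^ K * δ)) / F := by
  have hFpos : (0 : ℝ) < F := Nat.cast_pos.2 hF
  have hload (d : Fin K → Fin N) := abs_le.1 (hZ.abs_load_sub_le hM0 hMN hr hδ (hU d))
  obtain ⟨d₀, hd₀⟩ := exists_card_image_eq_min (K := K) hN
  obtain ⟨d₁, -, hd₁⟩ := exists_mem_eq_sup univ ⟨d₀, mem_univ _⟩ fun d => load Z d F (U d)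
  have hupper : F * limitRate N K M r #(univ.image d₁) ≤ F * Rdec N K M r s := by
    rw [← limitRate_min_eq_Rdec hs hM0 hMN hr]
    gcongr
    exact limitRate_mono hM0 hMN hr (card_image_le_min d₁)
  have hlower : F * Rdec N K M r s - 2 ^ K * (4 * (deviationFactor K ^ K * δ)) ≤
      load Z d₁ F (U d₁) := by
    rw [← limitRate_min_eq_Rdec hs hM0 hMN hr, ← hd₀, ← hd₁]
    have hle : (load Z d₀ F (U d₀) : ℝ) ≤ (univ.sup fun d => load Z d F (U d) : ℕ) :=
      Nat.cast_le.2 (le_sup (f := fun d => load Z d F (U d)) (mem_univ d₀))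
    linarith [(hload d₀).1]
  rw [worstRate, hd₁, div_sub' hFpos.ne', abs_div, abs_of_pos hFpos]
  gcongr
  exact abs_sub_le_iff.2 ⟨by linarith [(hload d₁).2], by linarith⟩

end Load

section NegativeCorrelation

open MeasureTheory ProbabilityTheory

variable {Ω ι : Type*} [MeasurableSpace Ω] {μ : Measure Ω} [IsProbabilityMeasure μ]

theorem measureReal_compl_inter_compl_le {s t : Set Ω} (hs : MeasurableSet s)
    (ht : MeasurableSet t) (hst : μ.real (s ∩ t) ≤ μ.real s * μ.real t) :
    μ.real (sᶜ ∩ tᶜ) ≤ μ.real sᶜ * μ.real tᶜ := by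
  have hunion := measureReal_union_add_inter (μ := μ) (s := s) ht
  rw [← Set.compl_union, probReal_compl_eq_one_sub (hs.union ht), probReal_compl_eq_one_sub hs,
    probReal_compl_eq_one_sub ht]
  linarith

theorem memLp_two_indicator_one {s : Set Ω} (hs : MeasurableSet s) :
    MemLp (s.indicator (1 : Ω → ℝ)) 2 μ :=
  memLp_indicator_const 2 hs 1 (.inr (measure_ne_top μ s))

theorem covariance_indicator_one {s t : Set Ω} (hs : MeasurableSet s) (ht : MeasurableSet t) :
    cov[s.indicator 1, t.indicator 1; μ] = μ.real (s ∩ t) - μ.real s * μ.real t := by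
  rw [covariance_eq_sub (memLp_two_indicator_one hs) (memLp_two_indicator_one ht),
    ← Set.inter_indicator_one, integral_indicator_one hs, integral_indicator_one ht,
    integral_indicator_one (hs.inter ht)]

variable [Fintype ι] {E : ι → Set Ω} (hE : ∀ t, MeasurableSet (E t))
  (hcorr : Pairwise fun t u => μ.real (E t ∩ E u) ≤ μ.real (E t) * μ.real (E u))
include hE hcorr

theorem variance_sum_indicator_one_le :
    Var[∑ t, (E t).indicator 1; μ] ≤ ∑ t, μ.real (E t) := by
  classical
  rw [variance_sum fun t => memLp_two_indicator_one (hE t)]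
  refine sum_le_sum fun t _ => ?_
  rw [← sum_erase_add _ _ (mem_univ t)]
  have hoff : ∑ u ∈ univ.erase t, cov[(E t).indicator 1, (E u).indicator 1; μ] ≤ 0 := by
    refine sum_nonpos fun u hu => ?_
    rw [covariance_indicator_one (hE t) (hE u)]
    exact sub_nonpos.2 (hcorr (ne_of_mem_erase hu).symm)
  have hdiag : cov[(E t).indicator 1, (E t).indicator 1; μ] ≤ μ.real (E t) := by
    rw [covariance_indicator_one (hE t) (hE t), Set.inter_self]
    exact sub_le_self _ (mul_self_nonneg _)
  exact (add_le_add hoff hdiag).trans_eq (zero_add _)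

theorem measureReal_le_abs_sum_indicator_one_sub_le {η : ℝ} (hη : 0 < η) :
    μ.real {ω | η ≤ |∑ t, (E t).indicator 1 ω - ∑ t, μ.real (E t)|} ≤
      (∑ t, μ.real (E t)) / η ^ 2 := by
  have hmean : μ[∑ t, (E t).indicator (1 : Ω → ℝ)] = ∑ t, μ.real (E t) := by
    simp_rw [Finset.sum_apply]
    rw [integral_finsetSum _ fun t _ => (memLp_two_indicator_one (hE t)).integrable one_le_two]
    exact sum_congr rfl fun t _ => integral_indicator_one (hE t)
  have hcheb := meas_ge_le_variance_div_sq
    (memLp_finsetSum' (μ := μ) univ fun t _ => memLp_two_indicator_one (hE t)) hη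
  rw [hmean] at hcheb
  simp only [Finset.sum_apply] at hcheb
  refine (ENNReal.toReal_le_of_le_ofReal
    (div_nonneg (variance_nonneg _ _) (sq_nonneg _)) hcheb).trans ?_
  gcongr
  exact variance_sum_indicator_one_le hE hcorr

end NegativeCorrelation

section RandomSubset

open MeasureTheory ProbabilityTheory

variable {α : Type*} [Fintype α] {c : ℕ}

theorem choose_mul_choose_add_two_le (m c : ℕ) :
    m.choose c * (m + 2).choose c ≤ (m + 1).choose c ^ 2 := by
  obtain hmc | hcm := Nat.lt_or_ge m c
  · simp [Nat.choose_eq_zero_of_lt hmc]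
  obtain ⟨x, rfl⟩ := Nat.exists_eq_add_of_le hcm
  have hstep₁ : (c + x).choose c * (c + x + 1) = (c + x + 1).choose c * (x + 1) := by
    rw [Nat.choose_mul_succ_eq]; congr 1; lia
  have hstep₂ : (c + x + 1).choose c * (c + x + 2) = (c + x + 2).choose c * (x + 2) := by
    rw [Nat.choose_mul_succ_eq]; congr 1; lia
  refine Nat.le_of_mul_le_mul_right (c := (c + x + 1) * (x + 2)) ?_ (by positivity)
  calc (c + x).choose c * (c + x + 2).choose c * ((c + x + 1) * (x + 2))
    _ = (c + x).choose c * (c + x + 1) * ((c + x + 2).choose c * (x + 2)) := by ring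
    _ = (c + x + 1).choose c ^ 2 * ((x + 1) * (c + x + 2)) := by rw [hstep₁, ← hstep₂]; ring
    _ ≤ (c + x + 1).choose c ^ 2 * ((c + x + 1) * (x + 2)) := Nat.mul_le_mul_left _ (by nlinarith)

theorem nonempty_subtype_card_eq (hc : c ≤ Fintype.card α) :
    Nonempty {T : Finset α // #T = c} := by
  obtain ⟨T, -, hT⟩ := exists_subset_card_eq (s := (univ : Finset α)) hc
  exact ⟨⟨T, hT⟩⟩

theorem uniformOn_real_disjoint (P : Finset α) :
    (uniformOn Set.univ).real {T : {T : Finset α // #T = c} | Disjoint T.1 P} =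
      (Fintype.card α - #P).choose c / (Fintype.card α).choose c := by
  classical
  have hcard : #{T : {T : Finset α // #T = c} | Disjoint T.1 P} =
      (Fintype.card α - #P).choose c := by
    rw [← card_compl, ← card_powersetCard]
    refine card_bij (fun T _ => T.1)
      (fun T hT => mem_powersetCard.2
        ⟨subset_compl_iff_disjoint_right.2 (mem_filter.1 hT).2, T.2⟩)
      (fun _ _ _ _ h => Subtype.ext h) fun T hT => ?_
    obtain ⟨hTP, hTc⟩ := mem_powersetCard.1 hT
    exact ⟨⟨T, hTc⟩, by simpa using subset_compl_iff_disjoint_right.1 hTP, rfl⟩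
  rw [measureReal_def, uniformOn_univ, ← coe_filter_univ, Measure.count_apply_finset, hcard]
  simp

variable (hc : c ≤ Fintype.card α)
include hc

theorem uniformOn_real_notMem (t : α) :
    (uniformOn Set.univ).real {T : {T : Finset α // #T = c} | t ∉ T.1} =
      1 - c / Fintype.card α := by
  have hdisjoint := uniformOn_real_disjoint (c := c) {t}
  simp only [disjoint_singleton_right, card_singleton] at hdisjoint
  obtain ⟨m, hm⟩ := Nat.exists_eq_add_one.2 (Fintype.card_pos_iff.2 ⟨t⟩)
  have hchoose : (m.choose c : ℝ) * (m + 1) = (m + 1).choose c * (m + 1 - c) := by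
    rw [← Nat.cast_add_one, ← Nat.cast_sub (hm ▸ hc)]
    exact_mod_cast Nat.choose_mul_succ_eq m c
  have hpos : (0 : ℝ) < (m + 1).choose c := Nat.cast_pos.2 (Nat.choose_pos (hm ▸ hc))
  rw [hdisjoint, hm, Nat.add_sub_cancel]
  push_cast
  field_simp
  exact hchoose

theorem uniformOn_real_mem_iff (t : α) (b : Prop) [Decidable b] :
    (uniformOn Set.univ).real {T : {T : Finset α // #T = c} | t ∈ T.1 ↔ b} =
      if b then (c : ℝ) / Fintype.card α else 1 - c / Fintype.card α := by
  have := nonempty_subtype_card_eq hc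
  split_ifs with hb
  · have hcompl := probReal_compl_eq_one_sub (μ := uniformOn Set.univ)
      (s := {T : {T : Finset α // #T = c} | t ∉ T.1}) .of_discrete
    rw [uniformOn_real_notMem hc, sub_sub_cancel] at hcompl
    simpa only [hb, iff_true, Set.compl_ofPred, not_not] using hcompl
  · simpa only [hb, iff_false] using uniformOn_real_notMem hc t

theorem uniformOn_real_notMem_inter_le {t u : α} (htu : t ≠ u) :
    (uniformOn Set.univ).real
        ({T : {T : Finset α // #T = c} | t ∉ T.1} ∩ {T | u ∉ T.1}) ≤
      (uniformOn Set.univ).real {T : {T : Finset α // #T = c} | t ∉ T.1} *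
        (uniformOn Set.univ).real {T : {T : Finset α // #T = c} | u ∉ T.1} := by
  classical
  have hdisjoint (v : α) := uniformOn_real_disjoint (c := c) {v}
  have hdisjoint_pair := uniformOn_real_disjoint (c := c) {t, u}
  simp only [disjoint_insert_right, disjoint_singleton_right, card_singleton, card_pair htu]
    at hdisjoint hdisjoint_pair
  obtain ⟨m, hm⟩ : ∃ m, Fintype.card α = m + 2 :=
    Nat.exists_eq_add_of_le' (Fintype.one_lt_card_iff.2 ⟨t, u, htu⟩)
  have hpos : (0 : ℝ) < (m + 2).choose c := Nat.cast_pos.2 (Nat.choose_pos (hm ▸ hc))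
  have hchoose : (m.choose c * (m + 2).choose c : ℝ) ≤ (m + 1).choose c ^ 2 := by
    exact_mod_cast choose_mul_choose_add_two_le m c
  rw [Set.inter_def]
  simp only [Set.mem_ofPred_eq]
  rw [hdisjoint_pair, hdisjoint, hdisjoint, hm, Nat.add_sub_cancel, Nat.add_succ_sub_one,
    div_mul_div_comm, div_le_div_iff₀ hpos (by positivity)]
  nlinarith

theorem uniformOn_real_mem_iff_inter_le {t u : α} (htu : t ≠ u) (b : Prop) :
    (uniformOn Set.univ).real
        ({T : {T : Finset α // #T = c} | t ∈ T.1 ↔ b} ∩ {T | u ∈ T.1 ↔ b}) ≤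
      (uniformOn Set.univ).real {T : {T : Finset α // #T = c} | t ∈ T.1 ↔ b} *
        (uniformOn Set.univ).real {T : {T : Finset α // #T = c} | u ∈ T.1 ↔ b} := by
  have := nonempty_subtype_card_eq hc
  have hnotMem := uniformOn_real_notMem_inter_le hc htu
  by_cases hb : b
  · simpa only [hb, iff_true, Set.compl_ofPred, not_not] using
      measureReal_compl_inter_compl_le .of_discrete .of_discrete hnotMem
  · simpa only [hb, iff_false] using hnotMem

end RandomSubset

section Placement

open MeasureTheory ProbabilityTheory

variable {K K' N n c : ℕ}

instance (K' N n c : ℕ) : MeasurableSingletonClass (Placement K' N n c) := ⟨fun _ => trivial⟩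

theorem isProbabilityMeasure_placementLaw (K' N : ℕ) (hc : c ≤ n) :
    IsProbabilityMeasure (placementLaw K' N n c) := by
  have := nonempty_subtype_card_eq (α := Fin n) (by simpa)
  have : Nonempty (Placement K' N n c) :=
    inferInstanceAs (Nonempty (Fin K' → Fin N → {T : Finset (Fin n) // #T = c}))
  exact instIsProbabilityMeasure_uniformOn_univ

theorem measurePreserving_placementLaw_pi (K' N n c : ℕ) :
    MeasurePreserving (fun (ω : Placement K' N n c) k i => ω k i) (placementLaw K' N n c)
      (Measure.pi fun _ : Fin K' => Measure.pi fun _ : Fin N =>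
        uniformOn (Set.univ : Set {T : Finset (Fin n) // #T = c})) := by
  refine ⟨measurable_from_top, Measure.ext fun S hS => ?_⟩
  simp_rw [← uniformOn_pi, Set.pi_univ]
  rw [Measure.map_apply measurable_from_top hS, placementLaw, uniformOn_univ, uniformOn_univ,
    Measure.count_apply .of_discrete, Measure.count_apply hS]
  rfl

theorem placementLaw_real_forall_mem (hc : c ≤ n) (e : Fin K ↪ Fin K') (i : Fin N)
    (P : Fin K → Set {T : Finset (Fin n) // #T = c}) :
    (placementLaw K' N n c).real {ω | ∀ k, ω (e k) i ∈ P k} =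
      ∏ k, (uniformOn Set.univ).real (P k) := by
  have := nonempty_subtype_card_eq (α := Fin n) (by simpa)
  let ν : Measure {T : Finset (Fin n) // #T = c} := uniformOn Set.univ
  have hindep : iIndepFun (fun k ω => ω (e k) i)
      (Measure.pi fun _ : Fin K' => Measure.pi fun _ : Fin N => ν) :=
    (iIndepFun_pi fun _ => (measurable_pi_apply i).aemeasurable).precomp e.injective
  have hmarginal (k : Fin K) : MeasurePreserving (fun ω : Fin K' → Fin N → _ => ω (e k) i)
      (Measure.pi fun _ : Fin K' => Measure.pi fun _ : Fin N => ν) ν :=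
    (measurePreserving_eval (fun _ => ν) i).comp (measurePreserving_eval _ (e k))
  have hevent : {ω : Placement K' N n c | ∀ k, ω (e k) i ∈ P k} =
      (fun ω k i => ω k i) ⁻¹' ⋂ k, (fun ω : Fin K' → Fin N → _ => ω (e k) i) ⁻¹' P k := by
    ext ω
    simp
  rw [hevent, (measurePreserving_placementLaw_pi K' N n c).measureReal_preimage
    MeasurableSet.of_discrete.nullMeasurableSet, measureReal_def,
    hindep.meas_iInter fun k => ⟨P k, .of_discrete, rfl⟩, ENNReal.toReal_prod]
  exact prod_congr rfl fun k _ =>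
    (hmarginal k).measureReal_preimage MeasurableSet.of_discrete.nullMeasurableSet

theorem setOf_mem_segment_caches (e : Fin K ↪ Fin K') (i : Fin N) (B : Finset (Fin K))
    (t : Fin n) :
    {ω : Placement K' N n c | t ∈ segment (ω.caches e) i B} =
      {ω | ∀ k, ω (e k) i ∈ {T : {T : Finset (Fin n) // #T = c} | t ∈ T.1 ↔ k ∈ B}} := by
  ext ω
  exact mem_segment

theorem prod_ite_mem_eq_pow_mul_pow {R : Type*} [CommMonoid R] (B : Finset (Fin K)) (a b : R) :
    ∏ k, (if k ∈ B then a else b) = a ^ #B * b ^ (K - #B) := by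
  simp [prod_ite, filter_not, card_sdiff_of_subset]

theorem placementLaw_real_mem_segment (hc : c ≤ n) (e : Fin K ↪ Fin K') (i : Fin N)
    (B : Finset (Fin K)) (t : Fin n) :
    (placementLaw K' N n c).real {ω | t ∈ segment (ω.caches e) i B} =
      (c / n : ℝ) ^ #B * (1 - c / n) ^ (K - #B) := by
  simp only [setOf_mem_segment_caches, placementLaw_real_forall_mem hc]
  simp_rw [uniformOn_real_mem_iff (α := Fin n) (by simpa), Fintype.card_fin]
  exact prod_ite_mem_eq_pow_mul_pow B _ _

theorem placementLaw_real_mem_segment_inter_le (hc : c ≤ n) (e : Fin K ↪ Fin K') (i : Fin N)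
    (B : Finset (Fin K)) {t u : Fin n} (htu : t ≠ u) :
    (placementLaw K' N n c).real
        ({ω | t ∈ segment (ω.caches e) i B} ∩ {ω | u ∈ segment (ω.caches e) i B}) ≤
      (placementLaw K' N n c).real {ω | t ∈ segment (ω.caches e) i B} *
        (placementLaw K' N n c).real {ω | u ∈ segment (ω.caches e) i B} := by
  have hinter : ({ω | t ∈ segment (ω.caches e) i B} ∩ {ω | u ∈ segment (ω.caches e) i B} :
      Set (Placement K' N n c)) = {ω | ∀ k, ω (e k) i ∈
        {T : {T : Finset (Fin n) // #T = c} | t ∈ T.1 ↔ k ∈ B} ∩ {T | u ∈ T.1 ↔ k ∈ B}} := by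
    ext ω
    simp only [setOf_mem_segment_caches, Set.mem_inter_iff, Set.mem_ofPred_eq, forall_and]
  rw [hinter, placementLaw_real_forall_mem hc]
  simp only [setOf_mem_segment_caches, placementLaw_real_forall_mem hc]
  rw [← prod_mul_distrib]
  exact prod_le_prod (fun _ _ => measureReal_nonneg) fun k _ =>
    uniformOn_real_mem_iff_inter_le (by simpa) htu _

theorem placementLaw_real_le_abs_card_segment_sub_le (hc : c ≤ n) (e : Fin K ↪ Fin K')
    (i : Fin N) (B : Finset (Fin K)) {η : ℝ} (hη : 0 < η) :
    (placementLaw K' N n c).real {ω | η ≤ |(#(segment (ω.caches e) i B) : ℝ) -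
      n * ((c / n : ℝ) ^ #B * (1 - c / n) ^ (K - #B))|} ≤ n / η ^ 2 := by
  have := isProbabilityMeasure_placementLaw K' N hc
  let E (t : Fin n) : Set (Placement K' N n c) := {ω | t ∈ segment (ω.caches e) i B}
  have hcount (ω : Placement K' N n c) :
      ∑ t, (E t).indicator (1 : Placement K' N n c → ℝ) ω = #(segment (ω.caches e) i B) := by
    simp [E, Set.indicator_apply]
  have hmean : ∑ t, (placementLaw K' N n c).real (E t) =
      n * ((c / n : ℝ) ^ #B * (1 - c / n) ^ (K - #B)) := by
    simp [E, placementLaw_real_mem_segment hc]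
  have hle : ∑ t, (placementLaw K' N n c).real (E t) ≤ n :=
    (sum_le_card_nsmul _ _ 1 fun _ _ => measureReal_le_one).trans_eq (by simp)
  have hcheb := measureReal_le_abs_sum_indicator_one_sub_le (E := E) (fun _ => .of_discrete)
    (fun _ _ htu => placementLaw_real_mem_segment_inter_le hc e i B htu) hη
  simp only [hcount, hmean] at hcheb hle
  exact hcheb.trans (by gcongr)

end Placement

section Convergence

open MeasureTheory Filter Topology

variable {K K' N : ℕ} {M r : ℝ}

theorem tendsto_codeLength_div (hr : 1 ≤ r) :
    Tendsto (fun F : ℕ => (codeLength r F : ℝ) / F) atTop (𝓝 r) :=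
  (tendsto_nat_floor_mul_div_atTop (by linarith : 0 ≤ r)).comp tendsto_natCast_atTop_atTop

theorem abs_cacheShare_sub_le (hM0 : 0 ≤ M) (N F : ℕ) :
    |(cacheShare M N F : ℝ) - F * (M / N)| ≤ 1 := by
  have hshare : M * F / N = F * (M / N) := by ring
  have hle := Nat.floor_le (show 0 ≤ M * F / N by positivity)
  have hlt := Nat.lt_floor_add_one (M * F / N)
  rw [hshare] at hle hlt
  rw [cacheShare, hshare, abs_sub_le_iff]
  constructor <;> linarith

theorem tendsto_cacheShare_div (hM0 : 0 ≤ M) (N : ℕ) :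
    Tendsto (fun F : ℕ => (cacheShare M N F : ℝ) / F) atTop (𝓝 (M / N)) := by
  have hfloor := (tendsto_nat_floor_mul_div_atTop (by positivity : 0 ≤ M / N)).comp
    tendsto_natCast_atTop_atTop
  refine hfloor.congr fun F => ?_
  simp only [Function.comp, cacheShare, mul_div_right_comm]

theorem tendsto_cacheShare_div_codeLength (hM0 : 0 ≤ M) (hr : 1 ≤ r) :
    Tendsto (fun F : ℕ => (cacheShare M N F : ℝ) / codeLength r F) atTop (𝓝 (q N M r)) := by
  have hdiv := (tendsto_cacheShare_div hM0 N).div (tendsto_codeLength_div hr) (by positivity)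
  rw [div_div, mul_comm (N : ℝ) r] at hdiv
  refine hdiv.congr' ?_
  filter_upwards [eventually_ne_atTop 0] with F hF
  exact div_div_div_cancel_right₀ (Nat.cast_ne_zero.2 hF) _ _

theorem tendsto_codeLength_mul_div_segmentDensity (hM0 : 0 ≤ M) (hr : 1 ≤ r) (b : ℕ) :
    Tendsto (fun F : ℕ => (codeLength r F * ((cacheShare M N F / codeLength r F : ℝ) ^ b *
      (1 - cacheShare M N F / codeLength r F) ^ (K - b))) / F) atTop
      (𝓝 (segmentDensity N K M r b)) := by
  have hq := tendsto_cacheShare_div_codeLength (N := N) hM0 hr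
  have hprod := (tendsto_codeLength_div hr).mul ((hq.pow b).mul ((hq.const_sub 1).pow (K - b)))
  rw [← mul_assoc] at hprod
  exact hprod.congr fun F => div_mul_eq_mul_div _ _ _

theorem tendsto_placementLaw_card_segment (hM0 : 0 ≤ M) (hMN : M ≤ N) (hr : 1 ≤ r)
    (e : Fin K ↪ Fin K') (i : Fin N) (B : Finset (Fin K)) {η : ℝ} (hη : 0 < η) :
    Tendsto (fun F : ℕ => (placementLaw K' N (codeLength r F) (cacheShare M N F)).real
      {ω | η * F < |(#(segment (ω.caches e) i B) : ℝ) - F * segmentDensity N K M r #B|})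
      atTop (𝓝 0) := by
  have hbound : Tendsto (fun F : ℕ => (codeLength r F : ℝ) / F * (4 / η ^ 2 / F)) atTop
      (𝓝 (r * 0)) :=
    (tendsto_codeLength_div hr).mul (tendsto_natCast_atTop_atTop.const_div_atTop _)
  rw [mul_zero] at hbound
  refine squeeze_zero' (.of_forall fun F => measureReal_nonneg) ?_ hbound
  filter_upwards [eventually_gt_atTop 0, Metric.tendsto_nhds.1
    (tendsto_codeLength_mul_div_segmentDensity (N := N) (K := K) hM0 hr #B) (η / 2) (half_pos hη)]
    with F hF hmean
  have hF' : (0 : ℝ) < F := Nat.cast_pos.2 hF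
  have hc := cacheShare_le_codeLength hMN hr F
  have := isProbabilityMeasure_placementLaw K' N hc
  rw [Real.dist_eq, div_sub' hF'.ne', abs_div, abs_of_pos hF', div_lt_iff₀ hF'] at hmean
  calc
    _ ≤ _ := measureReal_mono fun ω hω => ?_
    _ ≤ (codeLength r F : ℝ) / (η / 2 * F) ^ 2 :=
      placementLaw_real_le_abs_card_segment_sub_le hc e i B (by positivity)
    _ = _ := by field_simp; norm_num
  rw [Set.mem_ofPred_eq] at hω ⊢
  have htri := hω.trans_le (abs_sub_le _ (codeLength r F * ((cacheShare M N F / codeLength r F : ℝ)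
    ^ #B * (1 - cacheShare M N F / codeLength r F) ^ (K - #B))) _)
  linarith

theorem isBalanced_caches_iff (hM0 : 0 ≤ M) {F : ℕ} {δ : ℝ} (hδ : 1 ≤ δ)
    (ω : Placement K' N (codeLength r F) (cacheShare M N F)) (e : Fin K ↪ Fin K') :
    IsBalanced M r F δ (ω.caches e) ↔ ∀ i B,
      |(#(segment (ω.caches e) i B) : ℝ) - F * segmentDensity N K M r #B| ≤ δ := by
  refine and_iff_right fun k i => ?_
  rw [show #(ω.caches e k i) = cacheShare M N F from (ω (e k) i).2]
  exact (abs_cacheShare_sub_le hM0 N F).trans hδ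

theorem tendsto_placementLaw_isBalanced (hM0 : 0 ≤ M) (hMN : M ≤ N) (hr : 1 ≤ r) {η : ℝ}
    (hη : 0 < η) :
    Tendsto (fun F : ℕ => (placementLaw K' N (codeLength r F) (cacheShare M N F)).real
      {ω | ∀ e : Fin K ↪ Fin K', IsBalanced M r F (η * F) (ω.caches e)}) atTop (𝓝 1) := by
  let bad (F : ℕ) (e : Fin K ↪ Fin K') (i : Fin N) (B : Finset (Fin K)) :
      Set (Placement K' N (codeLength r F) (cacheShare M N F)) :=
    {ω | η * F < |(#(segment (ω.caches e) i B) : ℝ) - F * segmentDensity N K M r #B|}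
  have hbad : Tendsto (fun F : ℕ => 1 - ∑ e, ∑ i, ∑ B,
      (placementLaw K' N (codeLength r F) (cacheShare M N F)).real (bad F e i B)) atTop (𝓝 1) := by
    have hsum := tendsto_finsetSum univ fun e _ => tendsto_finsetSum univ fun i _ =>
      tendsto_finsetSum univ fun B _ =>
        tendsto_placementLaw_card_segment (K := K) (K' := K') hM0 hMN hr e i B hη
    simpa only [sum_const_zero, sub_zero] using hsum.const_sub 1
  refine tendsto_of_tendsto_of_tendsto_of_le_of_le' hbad tendsto_const_nhds ?_
    (.of_forall fun F => ?_)
  · filter_upwards [(tendsto_natCast_atTop_atTop.const_mul_atTop hη).eventually_ge_atTop 1]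
      with F hF
    have := isProbabilityMeasure_placementLaw K' N (cacheShare_le_codeLength hMN hr F)
    have hcompl := probReal_add_probReal_compl
      (μ := placementLaw K' N (codeLength r F) (cacheShare M N F))
      (s := {ω | ∀ e : Fin K ↪ Fin K', IsBalanced M r F (η * F) (ω.caches e)}) trivial
    have hsub : {ω | ∀ e : Fin K ↪ Fin K', IsBalanced M r F (η * F) (ω.caches e)}ᶜ ⊆
        ⋃ e, ⋃ i, ⋃ B, bad F e i B := fun ω hω => by
      simpa [isBalanced_caches_iff hM0 hF, bad] using hω
    have hunion := (measureReal_mono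
      (μ := placementLaw K' N (codeLength r F) (cacheShare M N F)) hsub).trans
      ((measureReal_iUnion_fintype_le _).trans <| sum_le_sum fun e _ =>
        (measureReal_iUnion_fintype_le _).trans <| sum_le_sum fun i _ =>
          measureReal_iUnion_fintype_le _)
    linarith
  · have := isProbabilityMeasure_placementLaw K' N (cacheShare_le_codeLength hMN hr F)
    exact measureReal_le_one

theorem tendsto_placementLaw_worstRate (hN : 1 ≤ N) (hM0 : 0 ≤ M) (hMN : M ≤ N) (hr : 1 ≤ r)
    {s : ℕ} (hs : IsThreshold N K M r s) {ε : ℝ} (hε : 0 < ε) :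
    Tendsto (fun F : ℕ => (placementLaw K' N (codeLength r F) (cacheShare M N F)).real
      {ω | ∀ (e : Fin K ↪ Fin K') (U : (Fin K → Fin N) → Finset (Fin K)),
        (∀ d, IsLeaderSet d (U d)) →
          |worstRate (ω.caches e) F U - Rdec N K M r s| ≤ ε}) atTop (𝓝 1) := by
  have hD : 0 < deviationFactor K ^ K := one_pos.trans_le (one_le_deviationFactor_pow K K)
  set η := ε / (2 ^ K * (4 * deviationFactor K ^ K)) with hηdef
  have hη : 0 < η := by positivity
  refine tendsto_of_tendsto_of_tendsto_of_le_of_le'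
    (tendsto_placementLaw_isBalanced (K := K) (K' := K') hM0 hMN hr hη) tendsto_const_nhds ?_
    (.of_forall fun F => ?_)
  · filter_upwards [eventually_gt_atTop 0,
      (tendsto_natCast_atTop_atTop.const_mul_atTop hη).eventually_ge_atTop 1] with F hF hηF
    have := isProbabilityMeasure_placementLaw K' N (cacheShare_le_codeLength hMN hr F)
    have hF' : (F : ℝ) ≠ 0 := Nat.cast_ne_zero.2 hF.ne'
    refine measureReal_mono fun ω hω e U hU =>
      ((hω e).abs_worstRate_sub_le hM0 hMN hr hηF hN hs hF hU).trans_eq ?_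
    rw [hηdef]
    field_simp
  · have := isProbabilityMeasure_placementLaw K' N (cacheShare_le_codeLength hMN hr F)
    exact measureReal_le_one

end Convergence

end CodedCaching

theorem mainTheorem1_general (N K K' : ℕ) (hN : 1 ≤ N) (hK : 1 ≤ K) (M r : ℝ) (hM0 : 0 ≤ M)
    (hMN : M ≤ N) (hr : 1 ≤ r) :
    (M < N → ∃! s, CodedCaching.IsThreshold N K M r s) ∧
    (∀ F : ℕ, ∃ (𝔽 : Type) (_ : Field 𝔽) (_ : Finite 𝔽) (_ : CharP 𝔽 2)
      (enc : (Fin F → 𝔽) →ₗ[𝔽] (Fin (CodedCaching.codeLength r F) → 𝔽)),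
      CodedCaching.IsMDS enc) ∧
    (∀ (F : ℕ) (ω : CodedCaching.Placement K' N (CodedCaching.codeLength r F)
        (CodedCaching.cacheShare M N F)) (k : Fin K'),
      ((∑ i, (ω k i).1.card : ℕ) : ℝ) ≤ M * F) ∧
    (∀ (F n : ℕ) (𝔽 : Type) [AddCommGroup 𝔽], (∀ x : 𝔽, x + x = 0) →
      ∀ enc : (Fin F → 𝔽) → (Fin n → 𝔽), CodedCaching.IsMDS enc →
      ∀ (Z : CodedCaching.Caches K N n) (d : Fin K → Fin N) (U : Finset (Fin K)),
        CodedCaching.IsLeaderSet d U → ∀ k : Fin K, CodedCaching.CanDecode enc Z d U k) ∧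
    (∀ s : ℕ, CodedCaching.IsThreshold N K M r s → ∀ ε : ℝ, 0 < ε →
      Filter.Tendsto
        (fun F : ℕ =>
          (CodedCaching.placementLaw K' N (CodedCaching.codeLength r F)
            (CodedCaching.cacheShare M N F)).real
            {ω | ∀ (e : Fin K ↪ Fin K') (U : (Fin K → Fin N) → Finset (Fin K)),
              (∀ d, CodedCaching.IsLeaderSet d (U d)) →
              |CodedCaching.worstRate (ω.caches e) F U - CodedCaching.Rdec N K M r s| ≤ ε})
        Filter.atTop (nhds 1)) :=
  ⟨fun hMN' => CodedCaching.existsUnique_isThreshold hK hM0 hMN' hr,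
    fun F => CodedCaching.exists_isMDS (CodedCaching.le_codeLength hr F),
    fun _ ω k => CodedCaching.sum_card_cache_le hM0 ω k,
    fun _ _ _ _ h2 _ henc Z _ _ hU k => CodedCaching.canDecode h2 henc Z hU k,
    fun _ hs _ hε => CodedCaching.tendsto_placementLaw_worstRate hN hM0 hMN hr hs hε⟩

theorem mainTheorem1 (N K K' : ℕ) (hN : 1 ≤ N) (hK : 1 ≤ K) (hKK' : K ≤ K')
    (M r : ℝ) (hM0 : 0 ≤ M) (hMN : M ≤ N) (hr : 1 ≤ r) :
    -- the threshold is well defined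
    (M < N → ∃! s, CodedCaching.IsThreshold N K M r s) ∧
    -- the MDS codes exist
    (∀ F : ℕ, ∃ (𝔽 : Type) (_ : Field 𝔽) (_ : Finite 𝔽) (_ : CharP 𝔽 2)
      (enc : (Fin F → 𝔽) →ₗ[𝔽] (Fin (CodedCaching.codeLength r F) → 𝔽)),
      CodedCaching.IsMDS enc) ∧
    -- every user respects the memory constraint
    (∀ (F : ℕ) (ω : CodedCaching.Placement K' N (CodedCaching.codeLength r F)
        (CodedCaching.cacheShare M N F)) (k : Fin K'),
      ((∑ i, (ω k i).1.card : ℕ) : ℝ) ≤ M * F) ∧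
    -- every requesting user decodes its file, for all requests and all choices of the leaders
    (∀ (F : ℕ) (𝔽 : Type) [Field 𝔽] [Finite 𝔽] [CharP 𝔽 2]
        (enc : (Fin F → 𝔽) → (Fin (CodedCaching.codeLength r F) → 𝔽)),
      CodedCaching.IsMDS enc →
      ∀ (ω : CodedCaching.Placement K' N (CodedCaching.codeLength r F)
          (CodedCaching.cacheShare M N F)) (e : Fin K ↪ Fin K') (d : Fin K → Fin N)
        (U : Finset (Fin K)), CodedCaching.IsLeaderSet d U →
      ∀ k : Fin K, CodedCaching.CanDecode enc (ω.caches e) d U k) ∧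
    -- the worst-case normalized rate tends to `Rdec` in probability as `F → ∞`
    (∀ s : ℕ, CodedCaching.IsThreshold N K M r s → ∀ ε : ℝ, 0 < ε →
      Filter.Tendsto
        (fun F : ℕ =>
          (CodedCaching.placementLaw K' N (CodedCaching.codeLength r F)
            (CodedCaching.cacheShare M N F)).real
            {ω | ∀ (e : Fin K ↪ Fin K') (U : (Fin K → Fin N) → Finset (Fin K)),
              (∀ d, CodedCaching.IsLeaderSet d (U d)) →
              |CodedCaching.worstRate (ω.caches e) F U - CodedCaching.Rdec N K M r s| ≤ ε})
        Filter.atTop (nhds 1)) := by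
  obtain ⟨hthreshold, hMDS, hmemory, hdecode, hrate⟩ :=
    mainTheorem1_general N K K' hN hK M r hM0 hMN hr
  exact ⟨hthreshold, hMDS, hmemory, fun F 𝔽 _ _ _ enc henc ω e =>
    hdecode F _ 𝔽 CharTwo.add_self_eq_zero enc henc (ω.caches e), hrate⟩
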